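/- **Green-Black Polygon Four Vertex Lemma.** Let $P=p_1\cdots p_n$ ($n\ge 3$) be a compact, strictly convex polygon in the hyperbolic plane $\mathbb H^2$ (curvature $-1$), with its vertices listed in counterclockwise cyclic order and with each edge and each vertex colored green or black. It is called a *green-black polygon* if (1) each green edge is adjacent to two black edges; (2) the vertices incident to a green edge are black, and all remaining vertices are green; (3) adjacent green and black edges are orthogonal. Two green-black polygons $P=p_1\cdots p_n$ and $P'=p_1'\cdots p_n'$ are *black-edge-congruent* if corresponding edges $p_ip_{i+1}$ and $p_i'p_{i+1}'$ have the same color for all $i$ (cyclically), and corresponding black edges have the same hyperbolic length. They are *congruent* if, moreover, corresponding green vertices have equal interior angles, corresponding green edges have equal lengths, and there is an isometry of $\mathbb H^2$ carrying $p_i$ to $p_i'$ for every $i$. Let $P$ and $P'$ be black-edge-congruent green-black polygons. Label each green vertex (respectively green edge) of $P$ with $+$ if its interior angle (respectively its length) is larger than that of the corresponding vertex (respectively edge) of $P'$, with $-$ if it is smaller, and with no label if they are equal; black vertices and edges get no label. Then either $P$ and $P'$ are congruent, or a closed walk once around $P$ (passing $p_1$, $p_1p_2$, $p_2$, $p_2p_3$,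 $\dots$, $p_n$, $p_np_1$ and returning to $p_1$) encounters at least four sign changes, i.e. in the cyclic sequence of labels met, with the unlabeled items omitted, at least four pairs of cyclically consecutive labels are of opposite sign. -/

import Mathlib

open UpperHalfPlane

/-- The two colours carried by the edges and vertices of a green-black polygon. -/
inductive GBColor where
  | green
  | black
deriving DecidableEq

noncomputable section

namespace HypPlane

/-- The position of `w` in the Poincaré disc model centred at `z`: the value at `w` of the
orientation-preserving (holomorphic) isometry `w ↦ (w - z) / (w - z̄)` from the upper half-plane
to the Poincaré disc that sends `z` to `0`. Geodesics through `z` become diameters of the disc. -/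
def discCoord (z w : ℍ) : ℂ :=
  ((w : ℂ) - (z : ℂ)) / ((w : ℂ) - (starRingEnd ℂ) (z : ℂ))

/-- The hyperbolic angle at `b` between the geodesic segments `ba` and `bc`, a number in `[0, π]`.
The disc model is conformal and the two segments are radial in the disc centred at `b`,
so this is the Euclidean angle between the two radii. -/
def hypAngle (a b c : ℍ) : ℝ :=
  InnerProductGeometry.angle (discCoord b a) (discCoord b c)

/-- `c` lies in the open half-plane to the left of the hyperbolic line through `a` and `b`,
oriented from `a` to `b`. In the disc centred at `a` that line is the oriented diameter through
the image `u` of `b`, and a point `v` is strictly to its left iff `Im (ū v) > 0`. -/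
def StrictlyLeft (a b c : ℍ) : Prop :=
  0 < ((starRingEnd ℂ) (discCoord a b) * discCoord a c).im

end HypPlane

/-- A green-black polygon with `n` vertices in the hyperbolic plane `ℍ` (curvature `-1`).
Indices are cyclic (arithmetic of `Fin n`); edge `i` joins vertex `i` to vertex `i + 1`. -/
structure GreenBlackPolygon (n : ℕ) [NeZero n] where
  /-- the vertices, in counterclockwise cyclic order -/
  vertex : Fin n → ℍ
  /-- the colour of the edge from vertex `i` to vertex `i + 1` -/
  edgeColor : Fin n → GBColor
  /-- the colour of vertex `i` -/
  vertexColor : Fin n → GBColor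
  three_le : 3 ≤ n
  /-- The vertices are the successive corners, listed counterclockwise, of a (compact) convex
  polygon: all the vertices off an edge lie strictly to the left of the line of that edge. -/
  convex : ∀ i j : Fin n, j ≠ i → j ≠ i + 1 →
    HypPlane.StrictlyLeft (vertex i) (vertex (i + 1)) (vertex j)
  /-- each green edge is adjacent to two black edges -/
  green_edge_adjacent : ∀ i, edgeColor i = GBColor.green →
    edgeColor (i - 1) = GBColor.black ∧ edgeColor (i + 1) = GBColor.black
  /-- the vertices incident to a green edge are black, and the remaining ones are green -/
  vertexColor_eq_black_iff : ∀ i, vertexColor i = GBColor.black ↔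
    (edgeColor (i - 1) = GBColor.green ∨ edgeColor i = GBColor.green)
  /-- adjacent edges of different colours are orthogonal -/
  orthogonal : ∀ i, edgeColor (i - 1) ≠ edgeColor i →
    HypPlane.hypAngle (vertex (i - 1)) (vertex i) (vertex (i + 1)) = Real.pi / 2

namespace GreenBlackPolygon

variable {n : ℕ} [NeZero n]

/-- The hyperbolic length of the edge from vertex `i` to vertex `i + 1`. -/
def edgeLength (P : GreenBlackPolygon n) (i : Fin n) : ℝ :=
  dist (P.vertex i) (P.vertex (i + 1))

/-- The interior angle at vertex `i`. -/
def interiorAngle (P : GreenBlackPolygon n) (i : Fin n) : ℝ :=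
  HypPlane.hypAngle (P.vertex (i - 1)) (P.vertex i) (P.vertex (i + 1))

/-- Compatible polygons: the same colours of edges in the same order. -/
def Compatible (P P' : GreenBlackPolygon n) : Prop :=
  ∀ i, P.edgeColor i = P'.edgeColor i

/-- Compatible polygons whose corresponding black edges have the same hyperbolic length. -/
def BlackEdgeCongruent (P P' : GreenBlackPolygon n) : Prop :=
  P.Compatible P' ∧ ∀ i, P.edgeColor i = GBColor.black → P.edgeLength i = P'.edgeLength i

/-- Congruence: black-edge-congruent polygons whose corresponding complex angles agree
(the angles at green vertices and the lengths of green edges), and which are moreover carried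
to each other, vertex by vertex, by an isometry of the hyperbolic plane. -/
def Congruent (P P' : GreenBlackPolygon n) : Prop :=
  P.BlackEdgeCongruent P' ∧
  (∀ i, P.vertexColor i = GBColor.green → P.interiorAngle i = P'.interiorAngle i) ∧
  (∀ i, P.edgeColor i = GBColor.green → P.edgeLength i = P'.edgeLength i) ∧
  ∃ g : ℍ ≃ᵢ ℍ, ∀ i, g (P.vertex i) = P'.vertex i

/-- The label of vertex `i` of `P`: for a green vertex `1` (a plus sign) if its angle is larger
than the corresponding angle of `P'`, `-1` (a minus sign) if it is smaller; `0` means no label. -/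
def vertexLabel (P P' : GreenBlackPolygon n) (i : Fin n) : SignType :=
  if P.vertexColor i = GBColor.green then
    SignType.sign (P.interiorAngle i - P'.interiorAngle i)
  else 0

/-- The label of edge `i` of `P`, in the same way: `1`, `-1`, or `0` for no label. -/
def edgeLabel (P P' : GreenBlackPolygon n) (i : Fin n) : SignType :=
  if P.edgeColor i = GBColor.green then
    SignType.sign (P.edgeLength i - P'.edgeLength i)
  else 0

/-- The labels met on one walk around `P`: vertex `0`, edge `0`, vertex `1`, edge `1`, … -/
def labels (P P' : GreenBlackPolygon n) : List SignType :=
  (List.finRange n).flatMap fun i => [P.vertexLabel P' i, P.edgeLabel P' i]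

/-- The number of sign changes in a cyclic list of labels: delete the missing labels, and count
the cyclically consecutive pairs of different signs (the last sign is followed by the first). -/
def cyclicSignChanges (l : List SignType) : ℕ :=
  let m := l.filter (fun s => s ≠ 0)
  (m.zip (m.rotate 1)).countP (fun p => p.1 ≠ p.2)

/-- The number of sign changes met on a walk around `P`, labelled by comparison with `P'`. -/
def signChanges (P P' : GreenBlackPolygon n) : ℕ :=
  cyclicSignChanges (P.labels P')

end GreenBlackPolygon

end

/-! The proof is Cauchy's arm lemma combined with a count of signs. A green edge acts as a vertex
beyond infinity: the lines of the two black edges orthogonal to it meet in its pole, and its length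
is an imaginary angle there. Angles at green vertices and lengths of green edges can therefore be
treated alike, with sine replaced by hyperbolic sine.

The number of sign changes around a cycle is even, so fewer than four means two or none. With two,
the boundary is cut at two black edges into an arc where `P` is nowhere smaller and an arc where it
is nowhere larger, each with a strict label. By the arm lemma `dist_mid_lt` the first arc makes the
distance between the midpoints of these edges larger in `P` than in `P'`, and the second makes it
smaller (`no_split`). With labels of one sign only, the monotone quantity of the arm lemma, carried
once around the polygon, returns to its initial value, which forbids a strict label away from the
black starting edge (`eq_of_dominates`). Such an edge exists for every label, because no hyperbolic
triangle has two right angles and no quadrilateral has four (`no_single_sign`). Without labels, the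
polygons are developed by the same motions and differ by an isometry (`congruent_of_lab_eq_zero`).

For the arm lemma every edge carries a frame in `SL(2, ℝ)`, and walking along the boundary
multiplies it on the right by boosts and turns. With the chord placed on the imaginary axis, frames
`M` and `M'` are compared through `cross M M' / cross M' M`. Common black edges leave this ratio
unchanged. Across a corner or a green edge its increment is a sine or hyperbolic sine of half the
difference, times a sum of two terms that convexity makes nonnegative, over a positive product
(`cross_turn_sub`, `cross_detour_sub`). The ratio is `1` at one end of the chord and `exp (D - D')`
at the other, where `D` and `D'` are the chord lengths. The denominators are positive by an argument
on the lifted polar angles of the matrix rows (`NotAhead`, `Behind`). -/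

open scoped MatrixGroups

/-! ### Hyperboloid coordinates, orientation and the Möbius action. -/

namespace HypPlane

/-- The hyperboloid coordinates of a point of the upper half-plane: with `x = z.re` and
`y = z.im` they are `1 / y`, `x / y` and `(x ^ 2 + y ^ 2) / y`. -/
noncomputable def coordA (z : ℍ) : ℝ := 1 / z.im

/-- The second hyperboloid coordinate `x / y`. -/
noncomputable def coordB (z : ℍ) : ℝ := z.re / z.im

/-- The third hyperboloid coordinate `(x ^ 2 + y ^ 2) / y`. -/
noncomputable def coordC (z : ℍ) : ℝ := (z.re ^ 2 + z.im ^ 2) / z.im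

/-- The orientation of a triple of points, the determinant of their hyperboloid coordinates. -/
noncomputable def orient (a b c : ℍ) : ℝ :=
  coordA a * (coordB b * coordC c - coordC b * coordB c)
    - coordB a * (coordA b * coordC c - coordC b * coordA c)
    + coordC a * (coordA b * coordB c - coordB b * coordA c)

theorem coordA_pos (z : ℍ) : 0 < coordA z := one_div_pos.2 z.im_pos

theorem coord_quadric (z : ℍ) : coordA z * coordC z - coordB z ^ 2 = 1 := by
  have := z.im_ne_zero
  unfold coordA coordB coordC
  field_simp
  ring

theorem ext_coord {z w : ℍ} (hA : coordA z = coordA w) (hB : coordB z = coordB w) : z = w := by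
  have hz := z.im_ne_zero
  have hw := w.im_ne_zero
  unfold coordA at hA
  unfold coordB at hB
  have h : z.im = w.im := by
    field_simp at hA
    exact hA.symm
  rw [h] at hB
  have h2 : z.re = w.re := by
    field_simp at hB
    exact hB
  exact UpperHalfPlane.ext (Complex.ext h2 h)

theorem sl_det (g : SL(2, ℝ)) : g 0 0 * g 1 1 - g 0 1 * g 1 0 = 1 := by
  have := g.det_coe
  rwa [Matrix.det_fin_two] at this

theorem normSq_denom_pos (g : SL(2, ℝ)) (z : ℍ) :
    0 < (g 1 0 * z.re + g 1 1) ^ 2 + (g 1 0 * z.im) ^ 2 := by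
  have hz := z.im_pos
  have hd := sl_det g
  by_cases h : g 1 0 = 0
  · have : g 1 1 ≠ 0 := by
      intro h'
      rw [h, h'] at hd
      norm_num at hd
    rw [h]
    have := sq_pos_of_ne_zero this
    nlinarith
  · have : 0 < (g 1 0 * z.im) ^ 2 := by positivity
    positivity

theorem coe_sl_smul (g : SL(2, ℝ)) (z : ℍ) :
    ((g • z : ℍ) : ℂ) = ((g 0 0 : ℝ) * (z : ℂ) + (g 0 1 : ℝ)) / ((g 1 0 : ℝ) * (z : ℂ) + (g 1 1 : ℝ)) := by
  rw [coe_specialLinearGroup_apply]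
  simp

theorem sl_smul_im (g : SL(2, ℝ)) (z : ℍ) :
    (g • z).im = z.im / ((g 1 0 * z.re + g 1 1) ^ 2 + (g 1 0 * z.im) ^ 2) := by
  have h := normSq_denom_pos g z
  have hd := sl_det g
  rw [← UpperHalfPlane.coe_im, coe_sl_smul, Complex.div_im]
  simp [Complex.normSq_apply]
  rw [← sub_div]
  congr 1
  · linear_combination z.im * hd
  · ring

theorem sl_smul_re (g : SL(2, ℝ)) (z : ℍ) :
    (g • z).re = ((g 0 0 * z.re + g 0 1) * (g 1 0 * z.re + g 1 1) + g 0 0 * g 1 0 * z.im ^ 2)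
      / ((g 1 0 * z.re + g 1 1) ^ 2 + (g 1 0 * z.im) ^ 2) := by
  rw [← UpperHalfPlane.coe_re, coe_sl_smul, Complex.div_re]
  simp [Complex.normSq_apply]
  rw [← add_div]
  congr 1 <;> ring

theorem coordA_smul (g : SL(2, ℝ)) (z : ℍ) :
    coordA (g • z) = g 1 0 ^ 2 * coordC z + 2 * g 1 0 * g 1 1 * coordB z + g 1 1 ^ 2 * coordA z := by
  have h := normSq_denom_pos g z
  have hz := z.im_ne_zero
  unfold coordA coordB coordC
  rw [sl_smul_im]
  field_simp
  ring

theorem coordB_smul (g : SL(2, ℝ)) (z : ℍ) :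
    coordB (g • z) = g 0 0 * g 1 0 * coordC z + (g 0 0 * g 1 1 + g 0 1 * g 1 0) * coordB z
      + g 0 1 * g 1 1 * coordA z := by
  have h := normSq_denom_pos g z
  have hz := z.im_ne_zero
  unfold coordA coordB coordC
  rw [sl_smul_im, sl_smul_re, div_div_div_cancel_right₀ h.ne']
  field_simp
  ring

theorem coordC_smul (g : SL(2, ℝ)) (z : ℍ) :
    coordC (g • z) = g 0 0 ^ 2 * coordC z + 2 * g 0 0 * g 0 1 * coordB z + g 0 1 ^ 2 * coordA z := by
  have hA := (coordA_pos (g • z)).ne'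
  have h1 := coord_quadric (g • z)
  have h2 := coord_quadric z
  have hd := sl_det g
  refine mul_left_cancel₀ hA ?_
  have : coordA (g • z) * coordC (g • z) = 1 + coordB (g • z) ^ 2 := by linarith
  rw [this, coordA_smul, coordB_smul]
  linear_combination (-(g 0 0 * g 1 1 - g 0 1 * g 1 0) ^ 2) * h2
    - (g 0 0 * g 1 1 - g 0 1 * g 1 0 + 1) * hd

theorem coord_I : coordA I = 1 ∧ coordB I = 0 ∧ coordC I = 1 := by
  simp [coordA, coordB, coordC]

theorem coordA_smul_I (g : SL(2, ℝ)) : coordA (g • I) = g 1 0 ^ 2 + g 1 1 ^ 2 := by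
  rw [coordA_smul, coord_I.1, coord_I.2.1, coord_I.2.2]; ring

theorem coordB_smul_I (g : SL(2, ℝ)) : coordB (g • I) = g 0 0 * g 1 0 + g 0 1 * g 1 1 := by
  rw [coordB_smul, coord_I.1, coord_I.2.1, coord_I.2.2]; ring

theorem coordC_smul_I (g : SL(2, ℝ)) : coordC (g • I) = g 0 0 ^ 2 + g 0 1 ^ 2 := by
  rw [coordC_smul, coord_I.1, coord_I.2.1, coord_I.2.2]; ring

/-- The action is linear in hyperboloid coordinates, with determinant the cube of `det g`. -/
theorem orient_smul (g : SL(2, ℝ)) (a b c : ℍ) :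
    orient (g • a) (g • b) (g • c) = orient a b c := by
  have hd := sl_det g
  have : orient (g • a) (g • b) (g • c)
      = (g 0 0 * g 1 1 - g 0 1 * g 1 0) ^ 3 * orient a b c := by
    unfold orient
    simp only [coordA_smul, coordB_smul, coordC_smul]
    ring
  rw [this, hd]
  ring

/-- The two expressions differ by a positive factor. The determinant has the advantage of being
multilinear in the coordinates. -/
theorem strictlyLeft_iff (a b c : ℍ) : StrictlyLeft a b c ↔ 0 < orient a b c := by
  have ha := a.im_pos
  have hb := b.im_pos
  have hc := c.im_pos
  have hB : 0 < (b.re - a.re) ^ 2 + (b.im + a.im) ^ 2 := by positivity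
  have hC : 0 < (c.re - a.re) ^ 2 + (c.im + a.im) ^ 2 := by positivity
  have key : ((starRingEnd ℂ) (discCoord a b) * discCoord a c).im
      = orient a b c * (2 * a.im ^ 2 * b.im * c.im)
        / (((b.re - a.re) ^ 2 + (b.im + a.im) ^ 2) * ((c.re - a.re) ^ 2 + (c.im + a.im) ^ 2)) := by
    unfold discCoord orient coordA coordB coordC
    rw [Complex.mul_im, Complex.conj_re, Complex.conj_im, Complex.div_re, Complex.div_im,
      Complex.div_re, Complex.div_im]
    simp [Complex.normSq_apply]
    rw [show (b.re - a.re) * (b.re - a.re) + (b.im + a.im) * (b.im + a.im)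
        = (b.re - a.re) ^ 2 + (b.im + a.im) ^ 2 by ring,
      show (c.re - a.re) * (c.re - a.re) + (c.im + a.im) * (c.im + a.im)
        = (c.re - a.re) ^ 2 + (c.im + a.im) ^ 2 by ring]
    field_simp
    ring
  unfold StrictlyLeft
  rw [key]
  constructor
  · intro h
    by_contra h'
    push Not at h'
    refine absurd h (not_lt.2 (div_nonpos_of_nonpos_of_nonneg ?_ (by positivity)))
    exact mul_nonpos_of_nonpos_of_nonneg h' (by positivity)
  · intro h
    positivity

/-- The factor is a quotient of conjugates and does not involve `w`: the disc centred at `z` is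
merely rotated, so angles at `z` are preserved. -/
theorem discCoord_smul (g : SL(2, ℝ)) (z w : ℍ) :
    discCoord (g • z) (g • w) =
      (((g 1 0 : ℝ) * (starRingEnd ℂ) (z : ℂ) + (g 1 1 : ℝ)) / ((g 1 0 : ℝ) * (z : ℂ) + (g 1 1 : ℝ)))
        * discCoord z w := by
  have hd : (g 0 0 : ℂ) * g 1 1 - g 0 1 * g 1 0 = 1 := by exact_mod_cast sl_det g
  have hne : ∀ z : ℍ, ((g 1 0 : ℝ) * (z : ℂ) + (g 1 1 : ℝ)) ≠ 0 := by
    intro z h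
    have h1 := congrArg Complex.re h
    have h2 := congrArg Complex.im h
    simp at h1 h2
    have := normSq_denom_pos g z
    have h3 : g 1 0 * z.im = 0 := by rcases h2 with h2 | h2 <;> simp [h2]
    rw [h1, h3] at this
    norm_num at this
  have hz := hne z
  have hw := hne w
  have hzc : ((g 1 0 : ℝ) * (starRingEnd ℂ) (z : ℂ) + (g 1 1 : ℝ)) ≠ 0 := by
    intro h
    apply hz
    have := congrArg (starRingEnd ℂ) h
    simpa using this
  have hwz : (w : ℂ) - (starRingEnd ℂ) (z : ℂ) ≠ 0 := by
    intro h
    have := congrArg Complex.im h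
    simp at this
    have := z.im_pos
    have := w.im_pos
    linarith
  unfold discCoord
  rw [coe_sl_smul, coe_sl_smul, map_div₀]
  simp only [map_add, map_mul, Complex.conj_ofReal]
  have e1 : ((g 0 0 : ℝ) * (w : ℂ) + (g 0 1 : ℝ)) / ((g 1 0 : ℝ) * (w : ℂ) + (g 1 1 : ℝ))
      - ((g 0 0 : ℝ) * (z : ℂ) + (g 0 1 : ℝ)) / ((g 1 0 : ℝ) * (z : ℂ) + (g 1 1 : ℝ))
      = ((w : ℂ) - z) / (((g 1 0 : ℝ) * (w : ℂ) + (g 1 1 : ℝ)) * ((g 1 0 : ℝ) * (z : ℂ) + (g 1 1 : ℝ))) := by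
    rw [div_sub_div _ _ hw hz]
    congr 1
    linear_combination ((w : ℂ) - z) * hd
  have e2 : ((g 0 0 : ℝ) * (w : ℂ) + (g 0 1 : ℝ)) / ((g 1 0 : ℝ) * (w : ℂ) + (g 1 1 : ℝ))
      - ((g 0 0 : ℝ) * (starRingEnd ℂ) (z : ℂ) + (g 0 1 : ℝ))
        / ((g 1 0 : ℝ) * (starRingEnd ℂ) (z : ℂ) + (g 1 1 : ℝ))
      = ((w : ℂ) - (starRingEnd ℂ) (z : ℂ)) / (((g 1 0 : ℝ) * (w : ℂ) + (g 1 1 : ℝ))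
        * ((g 1 0 : ℝ) * (starRingEnd ℂ) (z : ℂ) + (g 1 1 : ℝ))) := by
    rw [div_sub_div _ _ hw hzc]
    congr 1
    linear_combination ((w : ℂ) - (starRingEnd ℂ) (z : ℂ)) * hd
  rw [e1, e2]
  generalize ((g 1 0 : ℝ) * (w : ℂ) + (g 1 1 : ℝ)) = W at hw
  generalize ((g 1 0 : ℝ) * (z : ℂ) + (g 1 1 : ℝ)) = Z at hz
  field_simp

theorem hypAngle_smul (g : SL(2, ℝ)) (a b c : ℍ) :
    hypAngle (g • a) (g • b) (g • c) = hypAngle a b c := by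
  unfold hypAngle
  rw [discCoord_smul, discCoord_smul]
  apply Complex.angle_mul_left
  have hne : ((g 1 0 : ℝ) * (b : ℂ) + (g 1 1 : ℝ)) ≠ 0 := by
    intro h
    have h1 := congrArg Complex.re h
    have h2 := congrArg Complex.im h
    simp at h1 h2
    have := normSq_denom_pos g b
    have h3 : g 1 0 * b.im = 0 := by rcases h2 with h2 | h2 <;> simp [h2]
    rw [h1, h3] at this
    norm_num at this
  refine div_ne_zero (fun h => hne ?_) hne
  have := congrArg (starRingEnd ℂ) h
  simpa using this

/-! ### Frames: boosts and turns. -/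

/-- The transvection of length `t` along the imaginary axis. -/
noncomputable def boost (t : ℝ) : SL(2, ℝ) :=
  ⟨!![Real.exp (t / 2), 0; 0, Real.exp (-(t / 2))], by
    rw [Matrix.det_fin_two_of, ← Real.exp_add]; simp⟩

/-- The change of frame at a corner with interior angle `θ`: the rotation about `I` to the left
by the exterior angle `π - θ`. -/
noncomputable def turn (θ : ℝ) : SL(2, ℝ) :=
  ⟨!![Real.sin (θ / 2), Real.cos (θ / 2); -Real.cos (θ / 2), Real.sin (θ / 2)], by
    rw [Matrix.det_fin_two_of]; nlinarith [Real.sin_sq_add_cos_sq (θ / 2)]⟩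

section entries

variable (M : SL(2, ℝ)) (t : ℝ)

theorem mul_boost_00 : (M * boost t) 0 0 = M 0 0 * Real.exp (t / 2) := by
  rw [Matrix.SpecialLinearGroup.coe_mul, Matrix.mul_apply, Fin.sum_univ_two]; simp [boost]

theorem mul_boost_01 : (M * boost t) 0 1 = M 0 1 * Real.exp (-(t / 2)) := by
  rw [Matrix.SpecialLinearGroup.coe_mul, Matrix.mul_apply, Fin.sum_univ_two]; simp [boost]

theorem mul_boost_10 : (M * boost t) 1 0 = M 1 0 * Real.exp (t / 2) := by
  rw [Matrix.SpecialLinearGroup.coe_mul, Matrix.mul_apply, Fin.sum_univ_two]; simp [boost]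

theorem mul_boost_11 : (M * boost t) 1 1 = M 1 1 * Real.exp (-(t / 2)) := by
  rw [Matrix.SpecialLinearGroup.coe_mul, Matrix.mul_apply, Fin.sum_univ_two]; simp [boost]

theorem mul_turn_00 :
    (M * turn t) 0 0 = M 0 0 * Real.sin (t / 2) - M 0 1 * Real.cos (t / 2) := by
  rw [Matrix.SpecialLinearGroup.coe_mul, Matrix.mul_apply, Fin.sum_univ_two]; simp [turn]; ring

theorem mul_turn_01 :
    (M * turn t) 0 1 = M 0 0 * Real.cos (t / 2) + M 0 1 * Real.sin (t / 2) := by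
  rw [Matrix.SpecialLinearGroup.coe_mul, Matrix.mul_apply, Fin.sum_univ_two]; simp [turn]

theorem mul_turn_10 :
    (M * turn t) 1 0 = M 1 0 * Real.sin (t / 2) - M 1 1 * Real.cos (t / 2) := by
  rw [Matrix.SpecialLinearGroup.coe_mul, Matrix.mul_apply, Fin.sum_univ_two]; simp [turn]; ring

theorem mul_turn_11 :
    (M * turn t) 1 1 = M 1 0 * Real.cos (t / 2) + M 1 1 * Real.sin (t / 2) := by
  rw [Matrix.SpecialLinearGroup.coe_mul, Matrix.mul_apply, Fin.sum_univ_two]; simp [turn]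

theorem inv_entries :
    M⁻¹ 0 0 = M 1 1 ∧ M⁻¹ 0 1 = -M 0 1 ∧ M⁻¹ 1 0 = -M 1 0 ∧ M⁻¹ 1 1 = M 0 0 := by
  rw [Matrix.SpecialLinearGroup.SL2_inv_expl]
  simp

theorem sl_ext {M N : SL(2, ℝ)} (h00 : M 0 0 = N 0 0) (h01 : M 0 1 = N 0 1)
    (h10 : M 1 0 = N 1 0) (h11 : M 1 1 = N 1 1) : M = N := by
  ext i j
  fin_cases i <;> fin_cases j <;> assumption

end entries

theorem exp_half_mul (t : ℝ) : Real.exp (t / 2) * Real.exp (-(t / 2)) = 1 := by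
  rw [← Real.exp_add]; simp

theorem exp_half_sq (t : ℝ) : Real.exp (t / 2) ^ 2 = Real.exp t := by
  rw [← Real.exp_nat_mul]; congr 1; push_cast; ring

theorem exp_neg_half_sq (t : ℝ) : Real.exp (-(t / 2)) ^ 2 = Real.exp (-t) := by
  rw [← Real.exp_nat_mul]; congr 1; push_cast; ring

theorem boost_00 (t : ℝ) : boost t 0 0 = Real.exp (t / 2) := by simp [boost]
theorem boost_01 (t : ℝ) : boost t 0 1 = 0 := by simp [boost]
theorem boost_10 (t : ℝ) : boost t 1 0 = 0 := by simp [boost]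
theorem boost_11 (t : ℝ) : boost t 1 1 = Real.exp (-(t / 2)) := by simp [boost]

theorem boost_mul_boost (s t : ℝ) : boost s * boost t = boost (s + t) := by
  apply sl_ext
  · rw [mul_boost_00, boost_00, boost_00, ← Real.exp_add]; congr 1; ring
  · rw [mul_boost_01, boost_01, boost_01]; ring
  · rw [mul_boost_10, boost_10, boost_10]; ring
  · rw [mul_boost_11, boost_11, boost_11, ← Real.exp_add]; congr 1; ring

theorem boost_zero : boost 0 = 1 := by
  apply sl_ext <;> simp [boost]

/-- The middle hyperboloid coordinate of `M • I`; it vanishes on the imaginary axis and is positive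
to the right of it. -/
noncomputable def side (M : SL(2, ℝ)) : ℝ := M 0 0 * M 1 0 + M 0 1 * M 1 1

theorem side_eq (M : SL(2, ℝ)) : coordB (M • I) = side M := coordB_smul_I M

theorem side_mul_turn (M : SL(2, ℝ)) (θ : ℝ) : side (M * turn θ) = side M := by
  unfold side
  rw [mul_turn_00, mul_turn_01, mul_turn_10, mul_turn_11]
  linear_combination (M 0 0 * M 1 0 + M 0 1 * M 1 1) * Real.sin_sq_add_cos_sq (θ / 2)

theorem turn_smul_I (θ : ℝ) : turn θ • I = I := by
  apply ext_coord
  · rw [coordA_smul_I, coord_I.1]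
    simp [turn]
  · rw [coordB_smul_I, coord_I.2.1]
    simp [turn]
    ring

theorem coord_boost (t : ℝ) : coordA (boost t • I) = Real.exp (-t) ∧ coordB (boost t • I) = 0 ∧
    coordC (boost t • I) = Real.exp t := by
  rw [coordA_smul_I, coordB_smul_I, coordC_smul_I, boost_00, boost_01, boost_10, boost_11,
    exp_half_sq, exp_neg_half_sq]
  simp

/-- The orientation of a triple with respect to a frame of its first two points. -/
theorem orient_frame (g N : SL(2, ℝ)) (t : ℝ) :
    orient (g • I) ((g * boost t) • I) (N • I) = -side (g⁻¹ * N) * (2 * Real.sinh t) := by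
  rw [← orient_smul g⁻¹, inv_smul_smul, mul_smul, inv_smul_smul, ← mul_smul]
  unfold orient
  rw [coord_I.1, coord_I.2.1, coord_I.2.2, (coord_boost t).1, (coord_boost t).2.1,
    (coord_boost t).2.2, side_eq, Real.sinh_eq]
  ring

/-! ### Polar coordinates at a corner. -/

theorem cosh_dist_I (w : ℍ) : Real.cosh (dist I w) = (coordA w + coordC w) / 2 := by
  have hw := w.im_ne_zero
  rw [UpperHalfPlane.cosh_dist']
  unfold coordA coordC
  simp
  field_simp
  ring

theorem exists_rotation {x y : ℝ} (h : x ^ 2 + y ^ 2 = 1) :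
    ∃ φ : ℝ, Real.cos φ = x ∧ Real.sin φ = y := by
  have hn : ‖(⟨x, y⟩ : ℂ)‖ = 1 := by
    rw [Complex.norm_def, Complex.normSq_mk, ← sq, ← sq, h, Real.sqrt_one]
  have h0 : (⟨x, y⟩ : ℂ) ≠ 0 := by
    intro h0
    rw [h0] at hn
    simp at hn
  refine ⟨Complex.arg ⟨x, y⟩, ?_, ?_⟩
  · rw [Complex.cos_arg h0, hn, div_one]
  · rw [Complex.sin_arg, hn, div_one]

/-- Polar coordinates about `I`, with the angle measured from the downward axis, where the preceding
vertex lies. -/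
theorem turn_boost_coords (θ m : ℝ) :
    coordA ((turn θ * boost m) • I) = Real.cosh m + Real.cos θ * Real.sinh m ∧
    coordB ((turn θ * boost m) • I) = -(Real.sin θ * Real.sinh m) := by
  have h1 := Real.sin_sq_add_cos_sq (θ / 2)
  have hc : Real.cos θ = 2 * Real.cos (θ / 2) ^ 2 - 1 := by
    rw [← Real.cos_two_mul]; congr 1; ring
  have hs : Real.sin θ = 2 * Real.sin (θ / 2) * Real.cos (θ / 2) := by
    rw [← Real.sin_two_mul]; congr 1; ring
  rw [coordA_smul_I, coordB_smul_I, mul_boost_00, mul_boost_01, mul_boost_10, mul_boost_11,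
    Real.cosh_eq, Real.sinh_eq, ← exp_half_sq m, ← exp_neg_half_sq m, hc, hs]
  simp only [turn, Matrix.SpecialLinearGroup.coe_mk, Matrix.of_apply, Matrix.cons_val',
    Matrix.cons_val_zero, Matrix.cons_val_one, Matrix.cons_val_fin_one]
  constructor
  · linear_combination Real.exp (-(m / 2)) ^ 2 * h1
  · ring

/-- Any two points are the ends of a segment that starts in the direction of some frame. -/
theorem exists_frame (a b : ℍ) :
    ∃ g : SL(2, ℝ), g • I = a ∧ (g * boost (dist a b)) • I = b := by
  obtain ⟨g, hg⟩ := MulAction.exists_smul_eq SL(2, ℝ) I a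
  set w := g⁻¹ • b with hw
  have hd : dist I w = dist a b := by
    rw [← dist_smul g I w, hg, hw, smul_inv_smul]
  set m := dist a b with hm
  rcases eq_or_ne m 0 with h0 | h0
  · refine ⟨g, hg, ?_⟩
    rw [h0, boost_zero, mul_one, hg]
    exact dist_eq_zero.1 (hm ▸ h0)
  have hmpos : 0 < m := lt_of_le_of_ne dist_nonneg h0.symm
  have hsinh : 0 < Real.sinh m := Real.sinh_pos_iff.2 hmpos
  have hcosh : Real.cosh m = (coordA w + coordC w) / 2 := by rw [← hd, cosh_dist_I]
  have hq := coord_quadric w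
  -- These values are forced by `turn_boost_coords`; the quadric makes their squares add up to one.
  obtain ⟨φ, hc, hs⟩ : ∃ φ : ℝ, Real.cos φ = (coordA w - Real.cosh m) / Real.sinh m ∧
      Real.sin φ = -coordB w / Real.sinh m := by
    apply exists_rotation
    rw [div_pow, div_pow, ← add_div, div_eq_one_iff_eq (by positivity)]
    linear_combination Real.cosh_sq m - hq - 2 * coordA w * hcosh
  refine ⟨g * turn φ, by rw [mul_smul, turn_smul_I, hg], ?_⟩
  have : (turn φ * boost m) • I = w := by
    apply ext_coord
    · rw [(turn_boost_coords φ m).1, hc]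
      field_simp
      ring
    · rw [(turn_boost_coords φ m).2, hs]
      field_simp
  rw [mul_assoc, mul_smul, this, hw, smul_inv_smul]

/-- A point straight below `I` has a negative real disc coordinate, so the cosine is minus the real
part of the unit vector towards `w`. The factor `sinh` makes the result linear in the hyperboloid
coordinates. -/
theorem cos_hypAngle_boost {w : ℍ} {l : ℝ} (hl : 0 < l) (hw : 0 < dist I w) :
    Real.cos (hypAngle (boost (-l) • I) I w) * Real.sinh (dist I w) = (coordA w - coordC w) / 2 := by
  have him : (boost (-l) • I).im = Real.exp (-l) := by
    have h := (coord_boost (-l)).1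
    unfold coordA at h
    rw [one_div, inv_eq_iff_eq_inv, ← Real.exp_neg] at h
    rw [h, neg_neg]
  have hre : (boost (-l) • I).re = 0 := by
    have h := (coord_boost (-l)).2.1
    unfold coordB at h
    rcases div_eq_zero_iff.1 h with h | h
    · exact h
    · exact absurd h (UpperHalfPlane.im_ne_zero _)
  have hlt : Real.exp (-l) < 1 := by rw [Real.exp_lt_one_iff]; linarith
  have hpos := Real.exp_pos (-l)
  have hu : discCoord I (boost (-l) • I)
      = (((Real.exp (-l) - 1) / (Real.exp (-l) + 1) : ℝ)) • (1 : ℂ) := by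
    generalize Real.exp (-l) = e at *
    have hz : ((boost (-l) • I : ℍ) : ℂ) = e * Complex.I := by
      apply Complex.ext <;> simp [him, hre]
    have h1 : (e : ℂ) + 1 ≠ 0 := by
      have : (e + 1 : ℝ) ≠ 0 := by positivity
      exact_mod_cast this
    unfold discCoord
    rw [hz, Complex.real_smul, mul_one, UpperHalfPlane.coe_I, Complex.conj_I, Complex.ofReal_div,
      Complex.ofReal_sub, Complex.ofReal_add, Complex.ofReal_one, div_eq_div_iff _ h1]
    · ring
    · rw [show (e : ℂ) * Complex.I - -Complex.I = (e + 1) * Complex.I by ring]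
      exact mul_ne_zero h1 Complex.I_ne_zero
  have hneg : (Real.exp (-l) - 1) / (Real.exp (-l) + 1) < 0 :=
    div_neg_of_neg_of_pos (by linarith) (by linarith)
  have hy := w.im_pos
  have hN : 0 < w.re ^ 2 + (w.im + 1) ^ 2 := by positivity
  set v := discCoord I w with hv
  have hvre : v.re = (w.re ^ 2 + w.im ^ 2 - 1) / (w.re ^ 2 + (w.im + 1) ^ 2) := by
    rw [hv]
    unfold discCoord
    rw [Complex.div_re]
    simp [Complex.normSq_apply]
    rw [← add_div]
    congr 1 <;> ring
  have hvn : Complex.normSq v = (w.re ^ 2 + (w.im - 1) ^ 2) / (w.re ^ 2 + (w.im + 1) ^ 2) := by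
    rw [hv]
    unfold discCoord
    rw [Complex.normSq_div]
    simp [Complex.normSq_apply]
    congr 1 <;> ring
  have hch := cosh_dist_I w
  set m := dist I w with hm
  have hs : 0 < Real.sinh m := Real.sinh_pos_iff.2 hw
  have hc1 : 0 < Real.cosh m + 1 := by linarith [Real.one_le_cosh m]
  have hch2 : 2 * w.im * (Real.cosh m + 1) = w.re ^ 2 + (w.im + 1) ^ 2 := by
    rw [hch]
    unfold coordA coordC
    field_simp
    ring
  have hnorm : ‖v‖ = Real.sinh m / (Real.cosh m + 1) := by
    rw [Complex.norm_def, hvn]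
    refine (Real.sqrt_eq_iff_mul_self_eq (by positivity) (by positivity)).2 ?_
    rw [← hch2, show w.re ^ 2 + (w.im - 1) ^ 2 = 2 * w.im * (Real.cosh m + 1) - 4 * w.im by
      rw [hch2]; ring]
    have := Real.cosh_sq m
    field_simp
    nlinarith
  have hv0 : v ≠ 0 := by
    rw [← norm_pos_iff, hnorm]
    positivity
  have : Real.cos (hypAngle (boost (-l) • I) I w) = -(v.re / ‖v‖) := by
    unfold hypAngle
    rw [hu, InnerProductGeometry.angle_smul_left_of_neg _ _ hneg, InnerProductGeometry.angle_neg_left,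
      Real.cos_pi_sub, ← Complex.cos_arg hv0, Complex.angle_one_left hv0, Real.cos_abs]
  rw [this, hnorm, hvre, ← hch2]
  unfold coordA coordC
  field_simp
  ring

theorem hypAngle_nonneg (a b c : ℍ) : 0 ≤ hypAngle a b c := InnerProductGeometry.angle_nonneg _ _

theorem hypAngle_le_pi (a b c : ℍ) : hypAngle a b c ≤ Real.pi := InnerProductGeometry.angle_le_pi _ _

/-- Around a corner of a polygon: turning left by the exterior angle gives a frame of the next
edge. The corner is neither flat nor degenerate. -/
theorem frame_next {g : SL(2, ℝ)} {a b c : ℍ} (ha : g • I = a)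
    (hb : (g * boost (dist a b)) • I = b) (h : StrictlyLeft a b c) :
    (g * boost (dist a b) * turn (hypAngle a b c) * boost (dist b c)) • I = c ∧
      0 < hypAngle a b c ∧ hypAngle a b c < Real.pi := by
  set l := dist a b with hl
  set w := (g * boost l)⁻¹ • c with hw
  have hc : (g * boost l) • w = c := by rw [hw, smul_inv_smul]
  have ha' : (g * boost l) • (boost (-l) • I) = a := by
    rw [← mul_smul, mul_assoc, boost_mul_boost, add_neg_cancel, boost_zero, mul_one, ha]
  have hd : dist I w = dist b c := by rw [← dist_smul (g * boost l), hb, hc]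
  have hθ : hypAngle (boost (-l) • I) I w = hypAngle a b c := by
    rw [← hypAngle_smul (g * boost l), ha', hb, hc]
  rw [strictlyLeft_iff, ← ha', ← hb, ← hc, orient_smul] at h
  have ho : 0 < -coordB w * (2 * Real.sinh l) := by
    unfold orient at h
    rw [coord_I.1, coord_I.2.1, coord_I.2.2, (coord_boost _).1, (coord_boost _).2.1,
      (coord_boost _).2.2, neg_neg] at h
    rw [Real.sinh_eq]
    linarith
  have hl0 : 0 ≤ Real.sinh l := Real.sinh_nonneg_iff.2 dist_nonneg
  have hsl : 0 < Real.sinh l := by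
    rcases hl0.eq_or_lt with h0 | h0
    · rw [← h0] at ho; simp at ho
    · exact h0
  have hB : coordB w < 0 := by
    by_contra hB
    push Not at hB
    nlinarith
  have hlpos : 0 < l := Real.sinh_pos_iff.1 hsl
  have hmpos : 0 < dist I w := by
    refine lt_of_le_of_ne dist_nonneg fun h0 => ?_
    have := dist_eq_zero.1 h0.symm
    rw [← this, coord_I.2.1] at hB
    exact lt_irrefl _ hB
  have hcos := cos_hypAngle_boost hlpos hmpos
  have hcosh := cosh_dist_I w
  have hq := coord_quadric w
  set θ := hypAngle a b c with hθ'
  rw [hθ] at hcos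
  rw [hd] at hcos hcosh hmpos
  set m := dist b c with hm
  have hsm : 0 < Real.sinh m := Real.sinh_pos_iff.2 hmpos
  have hsin0 : 0 ≤ Real.sin θ :=
    Real.sin_nonneg_of_nonneg_of_le_pi (hypAngle_nonneg _ _ _) (hypAngle_le_pi _ _ _)
  -- The quadric determines the square; strict leftness selects the sign.
  have hBs : coordB w = -(Real.sin θ * Real.sinh m) := by
    have h1 : (Real.sin θ * Real.sinh m) ^ 2 = (-coordB w) ^ 2 := by
      have e1 := Real.sin_sq_add_cos_sq θ
      have e2 := Real.cosh_sq m
      have e3 : (Real.sin θ * Real.sinh m) ^ 2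
          = Real.sinh m ^ 2 - (Real.cos θ * Real.sinh m) ^ 2 := by
        linear_combination Real.sinh m ^ 2 * e1
      rw [e3, hcos]
      rw [hcosh] at e2
      linarith
    have := (sq_eq_sq₀ (by positivity) (by linarith)).1 h1
    linarith
  refine ⟨?_, ?_, ?_⟩
  · rw [mul_assoc (g * boost l), mul_smul, ← hc]
    congr 1
    apply ext_coord
    · rw [(turn_boost_coords θ m).1]
      linarith
    · rw [(turn_boost_coords θ m).2, hBs]
  · refine lt_of_le_of_ne (hypAngle_nonneg _ _ _) fun h0 => ?_
    rw [← h0] at hBs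
    simp at hBs
    linarith
  · refine lt_of_le_of_ne (hypAngle_le_pi _ _ _) fun h0 => ?_
    rw [h0] at hBs
    simp at hBs
    linarith

/-! ### Row determinants of two frames. -/

/-- The determinant formed by the first row of `M` and the second row of `N`. -/
noncomputable def cross (M N : SL(2, ℝ)) : ℝ := M 0 0 * N 1 1 - M 0 1 * N 1 0

/-- A boost scales the two columns by reciprocal factors, so a common black edge does not affect the
comparison. -/
theorem cross_mul_boost (M N : SL(2, ℝ)) (t : ℝ) :
    cross (M * boost t) (N * boost t) = cross M N := by
  unfold cross
  rw [mul_boost_00, mul_boost_11, mul_boost_01, mul_boost_10]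
  linear_combination (M 0 0 * N 1 1 - M 0 1 * N 1 0) * exp_half_mul t

/-- The change of frame along a green edge of length `d`, from the end of the black edge before it
to the start of the black edge after it. -/
noncomputable def detour (d : ℝ) : SL(2, ℝ) := turn (Real.pi / 2) * boost d * turn (Real.pi / 2)

theorem sin_pi_quarter_sq : Real.sin (Real.pi / 2 / 2) * Real.sin (Real.pi / 2 / 2) = 1 / 2 := by
  rw [show Real.pi / 2 / 2 = Real.pi / 4 by ring, Real.sin_pi_div_four]
  have := Real.mul_self_sqrt (show (0 : ℝ) ≤ 2 by norm_num)
  linarith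

theorem cos_pi_quarter : Real.cos (Real.pi / 2 / 2) = Real.sin (Real.pi / 2 / 2) := by
  rw [show Real.pi / 2 / 2 = Real.pi / 4 by ring, Real.sin_pi_div_four, Real.cos_pi_div_four]

section detour

variable (M : SL(2, ℝ)) (d : ℝ)

theorem mul_detour_00 : (M * detour d) 0 0 = M 0 0 * Real.sinh (d / 2) - M 0 1 * Real.cosh (d / 2) := by
  unfold detour
  rw [← mul_assoc, ← mul_assoc, mul_turn_00, mul_boost_00, mul_boost_01, mul_turn_00, mul_turn_01,
    cos_pi_quarter, Real.sinh_eq, Real.cosh_eq]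
  linear_combination ((M 0 0 - M 0 1) * Real.exp (d / 2) - (M 0 0 + M 0 1) * Real.exp (-(d / 2)))
    * sin_pi_quarter_sq

theorem mul_detour_01 : (M * detour d) 0 1 = M 0 0 * Real.cosh (d / 2) - M 0 1 * Real.sinh (d / 2) := by
  unfold detour
  rw [← mul_assoc, ← mul_assoc, mul_turn_01, mul_boost_00, mul_boost_01, mul_turn_00, mul_turn_01,
    cos_pi_quarter, Real.sinh_eq, Real.cosh_eq]
  linear_combination ((M 0 0 - M 0 1) * Real.exp (d / 2) + (M 0 0 + M 0 1) * Real.exp (-(d / 2)))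
    * sin_pi_quarter_sq

theorem mul_detour_10 : (M * detour d) 1 0 = M 1 0 * Real.sinh (d / 2) - M 1 1 * Real.cosh (d / 2) := by
  unfold detour
  rw [← mul_assoc, ← mul_assoc, mul_turn_10, mul_boost_10, mul_boost_11, mul_turn_10, mul_turn_11,
    cos_pi_quarter, Real.sinh_eq, Real.cosh_eq]
  linear_combination ((M 1 0 - M 1 1) * Real.exp (d / 2) - (M 1 0 + M 1 1) * Real.exp (-(d / 2)))
    * sin_pi_quarter_sq

theorem mul_detour_11 : (M * detour d) 1 1 = M 1 0 * Real.cosh (d / 2) - M 1 1 * Real.sinh (d / 2) := by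
  unfold detour
  rw [← mul_assoc, ← mul_assoc, mul_turn_11, mul_boost_10, mul_boost_11, mul_turn_10, mul_turn_11,
    cos_pi_quarter, Real.sinh_eq, Real.cosh_eq]
  linear_combination ((M 1 0 - M 1 1) * Real.exp (d / 2) + (M 1 0 + M 1 1) * Real.exp (-(d / 2)))
    * sin_pi_quarter_sq

end detour

/-- The analogue of `side` for the pole of the line that is orthogonal to the edge of the frame `M`
at its base point. -/
noncomputable def poleSide (M : SL(2, ℝ)) : ℝ := M 0 0 * M 1 0 - M 0 1 * M 1 1

theorem cross_turn (M M' : SL(2, ℝ)) (θ θ' : ℝ) :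
    cross (M * turn θ) (M' * turn θ') = Real.cos ((θ - θ') / 2) * cross M M'
      + Real.sin ((θ - θ') / 2) * (M 0 0 * M' 1 0 + M 0 1 * M' 1 1) := by
  unfold cross
  rw [mul_turn_00, mul_turn_11, mul_turn_01, mul_turn_10,
    show (θ - θ') / 2 = θ / 2 - θ' / 2 by ring, Real.cos_sub, Real.sin_sub]
  ring

theorem cross_detour (M M' : SL(2, ℝ)) (d d' : ℝ) :
    cross (M * detour d) (M' * detour d') = Real.cosh ((d - d') / 2) * cross M M'
      + Real.sinh ((d - d') / 2) * (M 0 0 * M' 1 0 - M 0 1 * M' 1 1) := by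
  unfold cross
  rw [mul_detour_00, mul_detour_11, mul_detour_01, mul_detour_10,
    show (d - d') / 2 = d / 2 - d' / 2 by ring, Real.cosh_sub, Real.sinh_sub]
  ring

/-- A discrete Wronskian: the cosine terms cancel, and unit determinants reduce the sine terms to
`side`. The left side is the numerator of the increment of the ratio across a corner. -/
theorem cross_turn_sub (M M' : SL(2, ℝ)) (θ θ' : ℝ) :
    cross (M * turn θ) (M' * turn θ') * cross M' M - cross M M' * cross (M' * turn θ') (M * turn θ)
      = Real.sin ((θ - θ') / 2) * (side M + side M') := by
  have h := sl_det M
  have h' := sl_det M'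
  rw [cross_turn, cross_turn, show (θ' - θ) / 2 = -((θ - θ') / 2) by ring, Real.cos_neg,
    Real.sin_neg]
  unfold cross side
  linear_combination Real.sin ((θ - θ') / 2) * ((M 0 0 * M 1 0 + M 0 1 * M 1 1) * h'
    + (M' 0 0 * M' 1 0 + M' 0 1 * M' 1 1) * h)

/-- The same Wronskian across a green edge, whose pole takes the place of the vertex. -/
theorem cross_detour_sub (M M' : SL(2, ℝ)) (d d' : ℝ) :
    cross (M * detour d) (M' * detour d') * cross M' M
        - cross M M' * cross (M' * detour d') (M * detour d)
      = Real.sinh ((d - d') / 2) * (poleSide M + poleSide M') := by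
  have h := sl_det M
  have h' := sl_det M'
  rw [cross_detour, cross_detour, show (d' - d) / 2 = -((d - d') / 2) by ring, Real.cosh_neg,
    Real.sinh_neg]
  unfold cross poleSide
  linear_combination Real.sinh ((d - d') / 2) * ((M 0 0 * M 1 0 - M 0 1 * M 1 1) * h'
    + (M' 0 0 * M' 1 0 - M' 0 1 * M' 1 1) * h)

/-- The signs after the detour read `M 0 1 * cosh ≤ M 0 0 * sinh` and `M 1 1 * sinh ≤ M 1 0 * cosh`.
When `M 0 1` is positive the two are multiplied and the common factor `sinh * cosh` cancels. -/
theorem poleSide_nonneg {M : SL(2, ℝ)} {d : ℝ} (hd : 0 < d) (h0 : 0 ≤ M 0 0) (h1 : 0 ≤ M 1 1)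
    (h0' : 0 ≤ (M * detour d) 0 0) (h1' : 0 ≤ (M * detour d) 1 1) : 0 ≤ poleSide M := by
  rw [mul_detour_00] at h0'
  rw [mul_detour_11] at h1'
  have hs : 0 < Real.sinh (d / 2) := Real.sinh_pos_iff.2 (by linarith)
  have hc := Real.cosh_pos (d / 2)
  have h10 : 0 ≤ M 1 0 := by
    by_contra h
    push Not at h
    nlinarith
  unfold poleSide
  rcases le_or_gt (M 0 1) 0 with h | h
  · nlinarith [mul_nonneg h0 h10]
  · have := mul_le_mul (sub_nonneg.1 h0') (sub_nonneg.1 h1') (by positivity) (by positivity)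
    have h2 : 0 ≤ (M 0 0 * M 1 0 - M 0 1 * M 1 1) * (Real.sinh (d / 2) * Real.cosh (d / 2)) := by
      linarith
    exact nonneg_of_mul_nonneg_left h2 (by positivity)

theorem poleSide_pos {M : SL(2, ℝ)} {d : ℝ} (hd : 0 < d) (h0 : 0 < M 0 0) (h1 : 0 < M 1 1)
    (h0' : 0 < (M * detour d) 0 0) (h1' : 0 < (M * detour d) 1 1) : 0 < poleSide M := by
  rw [mul_detour_00] at h0'
  rw [mul_detour_11] at h1'
  have hs : 0 < Real.sinh (d / 2) := Real.sinh_pos_iff.2 (by linarith)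
  have hc := Real.cosh_pos (d / 2)
  have h10 : 0 < M 1 0 := by
    by_contra h
    push Not at h
    nlinarith
  unfold poleSide
  rcases le_or_gt (M 0 1) 0 with h | h
  · nlinarith [mul_pos h0 h10]
  · have := mul_lt_mul'' (sub_pos.1 h0') (sub_pos.1 h1') (by positivity) (by positivity)
    have h2 : 0 < (M 0 0 * M 1 0 - M 0 1 * M 1 1) * (Real.sinh (d / 2) * Real.cosh (d / 2)) := by
      linarith
    exact pos_of_mul_pos_left h2 (by positivity)

/-! ### Comparison of the lifted polar angles of the rows. -/

section comparison

variable {M M' : SL(2, ℝ)}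

/-- In terms of lifted angles: the second row of `M` is less than a half turn ahead of the first
row of `M'`. -/
def NotAhead (M M' : SL(2, ℝ)) : Prop := 0 < cross M' M ∨ 0 < M 1 0

/-- In terms of lifted angles: the second row of `M` is not ahead of the first row of `M'`. -/
def Behind (M M' : SL(2, ℝ)) : Prop := cross M' M ≤ 0 ∧ 0 ≤ M 1 0

/-- Together the two conditions confine the difference of lifted angles to the open half turn where
the determinant is positive. -/
theorem cross_pos_of_notAhead (h : NotAhead M M') (h' : ¬Behind M M') : 0 < cross M' M := by
  by_contra hc
  rcases h with h | h
  · exact hc h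
  · exact h' ⟨not_lt.1 hc, h.le⟩

theorem NotAhead.boost (h : NotAhead M M') (t : ℝ) :
    NotAhead (M * boost t) (M' * HypPlane.boost t) := by
  rcases h with h | h
  · left; rwa [cross_mul_boost]
  · right; rw [mul_boost_10]; positivity

theorem Behind.boost (h : Behind M M') (t : ℝ) :
    Behind (M * boost t) (M' * HypPlane.boost t) := by
  refine ⟨by rw [cross_mul_boost]; exact h.1, ?_⟩
  rw [mul_boost_10]
  exact mul_nonneg h.2 (Real.exp_pos _).le

/-- Monotonicity of the tangent of the half angle, without denominators. -/
theorem sin_mul_cos_le {θ θ' : ℝ} (hθ : θ < Real.pi) (hθ' : 0 < θ') (h : θ' ≤ θ) :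
    Real.sin (θ' / 2) * Real.cos (θ / 2) ≤ Real.cos (θ' / 2) * Real.sin (θ / 2) := by
  have : 0 ≤ Real.sin (θ / 2 - θ' / 2) := Real.sin_nonneg_of_nonneg_of_le_pi (by linarith) (by linarith)
  rw [Real.sin_sub] at this
  linarith

theorem half_angle_pos {θ : ℝ} (h0 : 0 < θ) (hpi : θ < Real.pi) :
    0 < Real.sin (θ / 2) ∧ 0 < Real.cos (θ / 2) :=
  ⟨Real.sin_pos_of_pos_of_lt_pi (by linarith) (by linarith),
    Real.cos_pos_of_mem_Ioo ⟨by linarith, by linarith⟩⟩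

/-- A turn rotates the rows by half the exterior angle. The larger interior angle rotates less, so
the row of `M` that lags behind keeps lagging. -/
theorem Behind.turn {θ θ' : ℝ} (hθ0 : 0 < θ) (hθ : θ < Real.pi) (hθ'0 : 0 < θ')
    (hθ' : θ' < Real.pi) (hle : θ' ≤ θ)
    (h0 : 0 < M' 0 0) (h1 : 0 < M 1 1) (h0' : 0 ≤ (M' * turn θ') 0 0) (h : Behind M M') :
    Behind (M * turn θ) (M' * HypPlane.turn θ') := by
  obtain ⟨hc, h10⟩ := h
  have hs := half_angle_pos hθ0 hθ
  have hs' := half_angle_pos hθ'0 hθ'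
  have ht := sin_mul_cos_le hθ hθ'0 hle
  rw [mul_turn_00] at h0'
  have h10p : 0 < M 1 0 := by
    rcases h10.eq_or_lt with h | h
    · unfold cross at hc
      rw [← h] at hc
      nlinarith [mul_pos h0 h1]
    · exact h
  have h01 : 0 < M' 0 1 := by
    unfold cross at hc
    by_contra hn
    push Not at hn
    nlinarith [mul_pos h0 h1]
  constructor
  · rw [cross_turn, show (θ' - θ) / 2 = -((θ - θ') / 2) by ring, Real.cos_neg, Real.sin_neg]
    have e1 : 0 ≤ Real.cos ((θ - θ') / 2) := Real.cos_nonneg_of_mem_Icc ⟨by linarith, by linarith⟩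
    have e2 : 0 ≤ Real.sin ((θ - θ') / 2) :=
      Real.sin_nonneg_of_nonneg_of_le_pi (by linarith) (by linarith)
    have e3 : 0 < M' 0 0 * M 1 0 + M' 0 1 * M 1 1 := by positivity
    nlinarith [mul_nonneg e1 (neg_nonneg.2 hc), mul_nonneg e2 e3.le]
  · rw [mul_turn_10]
    unfold cross at hc
    have a1 : M' 0 0 * M 1 1 * Real.cos (θ' / 2) ≤ M' 0 0 * (M 1 0 * Real.sin (θ' / 2)) := by
      nlinarith [hs'.2]
    have a2 : M 1 1 * Real.cos (θ' / 2) ≤ M 1 0 * Real.sin (θ' / 2) := by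
      rw [mul_assoc] at a1
      exact le_of_mul_le_mul_left a1 h0
    have a3 : (M 1 1 * Real.cos (θ / 2)) * Real.cos (θ' / 2)
        ≤ (M 1 0 * Real.sin (θ / 2)) * Real.cos (θ' / 2) := by
      nlinarith [hs.2, mul_le_mul_of_nonneg_left ht h10p.le]
    have := le_of_mul_le_mul_right a3 hs'.2
    linarith

/-- The rows of `M` rotate no more than those of `M'`; a lead of half a turn after the corner would
have been present before it. -/
theorem NotAhead.turn {θ θ' : ℝ} (hθ0 : 0 < θ) (hθ : θ < Real.pi) (hθ'0 : 0 < θ')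
    (hθ' : θ' < Real.pi) (hle : θ' ≤ θ) (h0 : 0 ≤ M' 0 0)
    (h0' : 0 < (M' * turn θ') 0 0) (h1' : 0 < (M * turn θ) 1 1) (h : NotAhead M M') :
    NotAhead (M * turn θ) (M' * HypPlane.turn θ') := by
  by_contra hn
  unfold NotAhead at hn
  push Not at hn
  obtain ⟨hc, h10⟩ := hn
  have hs := half_angle_pos hθ0 hθ
  have hs' := half_angle_pos hθ'0 hθ'
  have ht := sin_mul_cos_le hθ hθ'0 hle
  -- The turns are undone: the data before the corner are expressed through those after it.
  have b0 : M' 0 0 = (M' * HypPlane.turn θ') 0 0 * Real.sin (θ' / 2)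
      + (M' * HypPlane.turn θ') 0 1 * Real.cos (θ' / 2) := by
    rw [mul_turn_00, mul_turn_01]
    linear_combination (-(M' 0 0)) * Real.sin_sq_add_cos_sq (θ' / 2)
  have b1 : M 1 0 = (M * HypPlane.turn θ) 1 0 * Real.sin (θ / 2)
      + (M * HypPlane.turn θ) 1 1 * Real.cos (θ / 2) := by
    rw [mul_turn_10, mul_turn_11]
    linear_combination (-(M 1 0)) * Real.sin_sq_add_cos_sq (θ / 2)
  have b2 : cross M' M = Real.cos ((θ - θ') / 2) * cross (M' * HypPlane.turn θ') (M * HypPlane.turn θ)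
      + Real.sin ((θ - θ') / 2) * ((M' * HypPlane.turn θ') 0 0 * (M * HypPlane.turn θ) 1 0
        + (M' * HypPlane.turn θ') 0 1 * (M * HypPlane.turn θ) 1 1) := by
    rw [cross_turn, mul_turn_00, mul_turn_01, mul_turn_10, mul_turn_11,
      show (θ' - θ) / 2 = θ' / 2 - θ / 2 by ring, show (θ - θ') / 2 = θ / 2 - θ' / 2 by ring]
    unfold cross
    rw [Real.cos_sub, Real.sin_sub, Real.cos_sub, Real.sin_sub]
    have e1 := Real.sin_sq_add_cos_sq (θ / 2)
    have e2 := Real.sin_sq_add_cos_sq (θ' / 2)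
    linear_combination (-(M' 0 0 * M 1 1 - M' 0 1 * M 1 0)
      * (Real.sin (θ' / 2) ^ 2 + Real.cos (θ' / 2) ^ 2)) * e1
      - (M' 0 0 * M 1 1 - M' 0 1 * M 1 0) * e2
  rw [b0] at h0
  set Y := (M' * HypPlane.turn θ') 0 0
  set Z := (M' * HypPlane.turn θ') 0 1
  set y := (M * HypPlane.turn θ) 1 0
  set z := (M * HypPlane.turn θ) 1 1
  have hc2 : Y * z ≤ Z * y := by
    have := hc
    unfold cross at this
    linarith
  have hy : y < 0 := by
    rcases h10.eq_or_lt with h | h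
    · rw [h] at hc2
      nlinarith [mul_pos h0' h1']
    · exact h
  have hZ : Z < 0 := by
    by_contra hZ
    push Not at hZ
    nlinarith [mul_pos h0' h1']
  have e1 : 0 ≤ Real.cos ((θ - θ') / 2) := Real.cos_nonneg_of_mem_Icc ⟨by linarith, by linarith⟩
  have e2 : 0 ≤ Real.sin ((θ - θ') / 2) :=
    Real.sin_nonneg_of_nonneg_of_le_pi (by linarith) (by linarith)
  rcases h with h | h
  · rw [b2] at h
    have e3 : Y * y + Z * z < 0 := by nlinarith
    nlinarith [mul_nonneg e1 (neg_nonneg.2 hc), mul_nonneg e2 (neg_nonneg.2 e3.le)]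
  · rw [b1] at h
    have a1 : Y * (z * Real.cos (θ' / 2)) ≤ Y * (-y * Real.sin (θ' / 2)) := by
      nlinarith [hs'.2]
    have a2 := le_of_mul_le_mul_left a1 h0'
    have a3 : (z * Real.cos (θ / 2)) * Real.cos (θ' / 2)
        ≤ (-y * Real.sin (θ / 2)) * Real.cos (θ' / 2) := by
      nlinarith [hs.2, mul_le_mul_of_nonneg_left ht (neg_nonneg.2 hy.le)]
    have := le_of_mul_le_mul_right a3 hs'.2
    linarith

/-- No comparison before the green edge is needed: after it the first row of `M'` has lifted angle
at least zero, while the second row of `M` stays below a half turn. -/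
theorem NotAhead.detour {d d' : ℝ} (hd' : 0 < d') (h0 : 0 ≤ M' 0 0)
    (h0' : 0 < (M' * detour d') 0 0) (h1' : 0 < (M * detour d) 1 1) :
    NotAhead (M * detour d) (M' * HypPlane.detour d') := by
  have hz : 0 ≤ (M' * HypPlane.detour d') 0 1 := by
    rw [mul_detour_00] at h0'
    rw [mul_detour_01]
    have hs : 0 < Real.sinh (d' / 2) := Real.sinh_pos_iff.2 (by linarith)
    have hc := Real.cosh_pos (d' / 2)
    have hlt := Real.sinh_lt_cosh (d' / 2)
    rcases le_or_gt (M' 0 1) 0 with h | h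
    · nlinarith [mul_nonneg h0 hc.le]
    · nlinarith
  by_contra hn
  unfold NotAhead at hn
  push Not at hn
  obtain ⟨hc, h10⟩ := hn
  unfold cross at hc
  nlinarith [mul_pos h0' h1', mul_nonneg hz (neg_nonneg.2 h10)]

/-- The hypotheses force `M' 0 1 ≤ M' 0 0` and `M 1 1 ≤ M 1 0`, which fixes the sign of the `sinh`
term in `cross_detour`. -/
theorem Behind.detour {d d' : ℝ} (hd' : 0 < d') (hle : d' ≤ d)
    (h0 : 0 < M' 0 0) (h1 : 0 < M 1 1) (h0' : 0 ≤ (M' * detour d') 0 0) (h : Behind M M') :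
    Behind (M * detour d) (M' * HypPlane.detour d') := by
  obtain ⟨hc, h10⟩ := h
  have hs : 0 < Real.sinh (d / 2) := Real.sinh_pos_iff.2 (by linarith)
  have hs' : 0 < Real.sinh (d' / 2) := Real.sinh_pos_iff.2 (by linarith)
  have hch := Real.cosh_pos (d / 2)
  have hch' := Real.cosh_pos (d' / 2)
  have hlt' := Real.sinh_lt_cosh (d' / 2)
  rw [mul_detour_00] at h0'
  have h10p : 0 < M 1 0 := by
    rcases h10.eq_or_lt with h | h
    · unfold cross at hc
      rw [← h] at hc
      nlinarith [mul_pos h0 h1]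
    · exact h
  have h01 : 0 < M' 0 1 := by
    unfold cross at hc
    by_contra hn
    push Not at hn
    nlinarith [mul_pos h0 h1]
  have a1 : M' 0 0 * (M 1 1 * Real.cosh (d' / 2)) ≤ M' 0 0 * (M 1 0 * Real.sinh (d' / 2)) := by
    unfold cross at hc
    nlinarith
  have a2 := le_of_mul_le_mul_left a1 h0
  constructor
  · rw [cross_detour, show (d' - d) / 2 = -((d - d') / 2) by ring, Real.cosh_neg, Real.sinh_neg]
    have e1 := Real.cosh_pos ((d - d') / 2)
    have e2 : 0 ≤ Real.sinh ((d - d') / 2) := Real.sinh_nonneg_iff.2 (by linarith)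
    have f1 : M' 0 1 ≤ M' 0 0 := by
      by_contra hn
      push Not at hn
      nlinarith
    have f2 : M 1 1 ≤ M 1 0 := by
      by_contra hn
      push Not at hn
      nlinarith
    have e3 : 0 ≤ M' 0 0 * M 1 0 - M' 0 1 * M 1 1 := by
      have := mul_le_mul f1 f2 h1.le h0.le
      linarith
    nlinarith [mul_nonneg e1.le (neg_nonneg.2 hc), mul_nonneg e2 e3]
  · rw [mul_detour_10]
    have ht : Real.sinh (d' / 2) * Real.cosh (d / 2) ≤ Real.cosh (d' / 2) * Real.sinh (d / 2) := by
      have : 0 ≤ Real.sinh (d / 2 - d' / 2) := Real.sinh_nonneg_iff.2 (by linarith)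
      rw [Real.sinh_sub] at this
      linarith
    have a3 : (M 1 1 * Real.cosh (d / 2)) * Real.cosh (d' / 2)
        ≤ (M 1 0 * Real.sinh (d / 2)) * Real.cosh (d' / 2) := by
      nlinarith [mul_le_mul_of_nonneg_left ht h10p.le]
    have := le_of_mul_le_mul_right a3 hch'
    linarith

end comparison

/-! ### The arm lemma for chains of frames. -/

/-- The frames at the starts of the successive edges of a green-black polygon. -/
structure IsFrameChain (green : ℕ → Prop) (l θ : ℕ → ℝ) (M : ℕ → SL(2, ℝ)) : Prop where
  step : ∀ j, M (j + 1) = M j * boost (l j) * turn (θ (j + 1))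
  length_pos : ∀ j, 0 < l j
  angle_pos : ∀ j, 0 < θ j
  angle_lt : ∀ j, θ j < Real.pi
  right : ∀ j, green j → θ j = Real.pi / 2 ∧ θ (j + 1) = Real.pi / 2
  isolated : ∀ j, green j → ¬green (j + 1)

/-- The sign conditions satisfied by the frames along an arc of a convex polygon that lies to the
right of the imaginary axis and connects two points of that axis. -/
structure IsRightArc (green : ℕ → Prop) (A B : ℕ) (M : ℕ → SL(2, ℝ)) : Prop where
  window : ∀ j, A < j → j < B → 0 < M j 0 0 ∧ 0 < M j 1 1
  window_left : 0 ≤ M A 0 0 ∧ 0 ≤ M A 1 1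
  window_right : 0 ≤ M B 0 0 ∧ 0 ≤ M B 1 1
  side : ∀ j, A < j → j ≤ B → 0 ≤ side (M j)

theorem IsRightArc.window_nonneg {green : ℕ → Prop} {A B : ℕ} {M : ℕ → SL(2, ℝ)}
    (h : IsRightArc green A B M) {j : ℕ} (h1 : A ≤ j) (h2 : j ≤ B) : 0 ≤ M j 0 0 ∧ 0 ≤ M j 1 1 := by
  rcases h1.eq_or_lt with rfl | h1
  · exact h.window_left
  rcases h2.eq_or_lt with rfl | h2
  · exact h.window_right
  have := h.window j h1 h2
  exact ⟨this.1.le, this.2.le⟩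

theorem IsFrameChain.two_step {green : ℕ → Prop} {l θ : ℕ → ℝ} {M : ℕ → SL(2, ℝ)}
    (h : IsFrameChain green l θ M) {j : ℕ} (hj : green (j + 1)) :
    M (j + 2) = M j * boost (l j) * detour (l (j + 1)) := by
  have h2 := h.right _ hj
  rw [h.step (j + 1), h.step j, h2.1, h2.2]
  unfold detour
  group

/-- Green edges are isolated, so the next black edge is one or two steps away. Frames are compared
only at black edges, where the lengths agree. -/
theorem black_induction {green : ℕ → Prop} (hg : ∀ j, green j → ¬green (j + 1)) {p : ℕ → Prop}
    {A : ℕ} (hA : ¬green A) (h0 : p A)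
    (h1 : ∀ j, A ≤ j → ¬green j → ¬green (j + 1) → p j → p (j + 1))
    (h2 : ∀ j, A ≤ j → ¬green j → green (j + 1) → ¬green (j + 2) → p j → p (j + 2))
    (j : ℕ) (hj : A ≤ j) (hb : ¬green j) : p j := by
  induction j using Nat.strong_induction_on with
  | _ j ih =>
    rcases hj.eq_or_lt with rfl | hlt
    · exact h0
    obtain ⟨k, rfl⟩ := Nat.exists_eq_add_of_lt hlt
    by_cases hk : green (A + k)
    · rcases k with _ | k
      · exact absurd hk hA
      · have hk' : ¬green (A + k) := fun h => hg _ h hk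
        exact h2 (A + k) (by omega) hk' hk hb (ih (A + k) (by omega) (by omega) hk')
    · exact h1 (A + k) (by omega) hk hb (ih (A + k) (by omega) (by omega) hk)

/-- Two frame chains with the same colours and the same lengths of black edges, along arcs to the
right of a chord; the angles and the green edges of the first are at least those of the second. -/
structure IsArmPair (green : ℕ → Prop) (A B : ℕ) (l l' θ θ' : ℕ → ℝ) (M M' : ℕ → SL(2, ℝ)) :
    Prop where
  chain : IsFrameChain green l θ M
  chain' : IsFrameChain green l' θ' M'
  arc : IsRightArc green A B M
  arc' : IsRightArc green A B M'
  length_eq : ∀ j, ¬green j → l j = l' j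
  angle_le : ∀ j, A ≤ j → j < B → ¬green j → ¬green (j + 1) → θ' (j + 1) ≤ θ (j + 1)
  length_le : ∀ j, A ≤ j → j + 1 < B → green (j + 1) → l' (j + 1) ≤ l (j + 1)
  black_left : ¬green A
  black_right : ¬green B
  cross_left : 0 < cross (M' A) (M A)
  cross_right : 0 < cross (M' B) (M B)

namespace IsArmPair

variable {green : ℕ → Prop} {A B : ℕ} {l l' θ θ' : ℕ → ℝ} {M M' : ℕ → SL(2, ℝ)}

theorem notAhead (h : IsArmPair green A B l l' θ θ' M M') (j : ℕ) (hj : A ≤ j) (hb : ¬green j) :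
    j < B → NotAhead (M j) (M' j) := by
  refine black_induction h.chain.isolated (p := fun j => j < B → NotAhead (M j) (M' j))
    h.black_left ?_ ?_ ?_ j hj hb
  · exact fun _ => Or.inl h.cross_left
  · intro j hAj hj hj1 ih hB
    rw [h.chain.step, h.chain'.step, ← h.length_eq j hj]
    have w := h.arc.window (j + 1) (by omega) hB
    have w' := h.arc'.window (j + 1) (by omega) hB
    rw [h.chain.step] at w
    rw [h.chain'.step, ← h.length_eq j hj] at w'
    refine ((ih (by omega)).boost (l j)).turn (h.chain.angle_pos _) (h.chain.angle_lt _)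
      (h.chain'.angle_pos _) (h.chain'.angle_lt _) (h.angle_le j hAj (by omega) hj hj1) ?_ w'.1 w.2
    rw [mul_boost_00]
    exact mul_nonneg (h.arc'.window_nonneg hAj (by omega)).1 (Real.exp_pos _).le
  · intro j hAj hj hj1 hj2 ih hB
    have w := h.arc.window (j + 2) (by omega) hB
    have w' := h.arc'.window (j + 2) (by omega) hB
    rw [h.chain.two_step hj1] at w ⊢
    rw [h.chain'.two_step hj1, ← h.length_eq j hj] at w' ⊢
    refine NotAhead.detour (h.chain'.length_pos _) ?_ w'.1 w.2
    rw [mul_boost_00]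
    exact mul_nonneg (h.arc'.window_nonneg hAj (by omega)).1 (Real.exp_pos _).le

theorem not_behind (h : IsArmPair green A B l l' θ θ' M M') {i : ℕ} (hi : A < i) (hiB : i ≤ B)
    (hib : ¬green i) : ¬Behind (M i) (M' i) := by
  intro hbeh
  -- Lagging persists as far as `B`, where it contradicts the positive determinant.
  have key : B ≤ B → Behind (M B) (M' B) := by
    refine black_induction h.chain.isolated (p := fun j => j ≤ B → Behind (M j) (M' j))
      hib (fun _ => hbeh) ?_ ?_ B hiB h.black_right
    · intro j hAj hj hj1 ih hB
      have w := h.arc.window j (by omega) (by omega)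
      have w' := h.arc'.window j (by omega) (by omega)
      have v' := (h.arc'.window_nonneg (j := j + 1) (by omega) hB).1
      rw [h.chain'.step, ← h.length_eq j hj] at v' ⊢
      rw [h.chain.step]
      refine ((ih (by omega)).boost (l j)).turn (h.chain.angle_pos _) (h.chain.angle_lt _)
        (h.chain'.angle_pos _) (h.chain'.angle_lt _) (h.angle_le j (by omega) (by omega) hj hj1)
        ?_ ?_ v'
      · rw [mul_boost_00]
        exact mul_pos w'.1 (Real.exp_pos _)
      · rw [mul_boost_11]
        exact mul_pos w.2 (Real.exp_pos _)
    · intro j hAj hj hj1 hj2 ih hB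
      have w := h.arc.window j (by omega) (by omega)
      have w' := h.arc'.window j (by omega) (by omega)
      have v' := (h.arc'.window_nonneg (j := j + 2) (by omega) hB).1
      rw [h.chain'.two_step hj1, ← h.length_eq j hj] at v' ⊢
      rw [h.chain.two_step hj1]
      refine Behind.detour (h.chain'.length_pos _) (h.length_le j (by omega) (by omega) hj1)
        ?_ ?_ v' ((ih (by omega)).boost (l j))
      · rw [mul_boost_00]
        exact mul_pos w'.1 (Real.exp_pos _)
      · rw [mul_boost_11]
        exact mul_pos w.2 (Real.exp_pos _)
  exact absurd (key le_rfl).1 (not_le.2 h.cross_right)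

theorem cross_pos (h : IsArmPair green A B l l' θ θ' M M') {j : ℕ} (hA : A ≤ j) (hB : j ≤ B)
    (hb : ¬green j) : 0 < cross (M' j) (M j) := by
  rcases hA.eq_or_lt with rfl | hA'
  · exact h.cross_left
  rcases hB.eq_or_lt with rfl | hB'
  · exact h.cross_right
  exact cross_pos_of_notAhead (h.notAhead j hA hb hB') (h.not_behind hA' hB hb)

theorem angle_sub (h : IsArmPair green A B l l' θ θ' M M') {j : ℕ} (hj : ¬green j) :
    cross (M (j + 1)) (M' (j + 1)) * cross (M' j) (M j)
        - cross (M j) (M' j) * cross (M' (j + 1)) (M (j + 1))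
      = Real.sin ((θ (j + 1) - θ' (j + 1)) / 2) * (HypPlane.side (M (j + 1)) + HypPlane.side (M' (j + 1))) := by
  have e := cross_turn_sub (M j * boost (l j)) (M' j * boost (l j)) (θ (j + 1)) (θ' (j + 1))
  rw [cross_mul_boost, cross_mul_boost] at e
  rw [h.chain.step, h.chain'.step, ← h.length_eq j hj, side_mul_turn, side_mul_turn]
  exact e

theorem detour_sub (h : IsArmPair green A B l l' θ θ' M M') {j : ℕ} (hj : ¬green j)
    (hj1 : green (j + 1)) :
    cross (M (j + 2)) (M' (j + 2)) * cross (M' j) (M j)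
        - cross (M j) (M' j) * cross (M' (j + 2)) (M (j + 2))
      = Real.sinh ((l (j + 1) - l' (j + 1)) / 2)
        * (poleSide (M j * boost (l j)) + poleSide (M' j * boost (l j))) := by
  have e := cross_detour_sub (M j * boost (l j)) (M' j * boost (l j)) (l (j + 1)) (l' (j + 1))
  rw [cross_mul_boost, cross_mul_boost] at e
  rw [h.chain.two_step hj1, h.chain'.two_step hj1, ← h.length_eq j hj]
  exact e

theorem sin_nonneg (h : IsArmPair green A B l l' θ θ' M M') {j : ℕ} (hA : A ≤ j) (hB : j < B)
    (hj : ¬green j) (hj1 : ¬green (j + 1)) : 0 ≤ Real.sin ((θ (j + 1) - θ' (j + 1)) / 2) := by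
  have h1 := h.angle_le j hA hB hj hj1
  have h2 := h.chain.angle_lt (j + 1)
  have h3 := h.chain'.angle_pos (j + 1)
  exact Real.sin_nonneg_of_nonneg_of_le_pi (by linarith) (by linarith)

theorem poleSide_nonneg (h : IsArmPair green A B l l' θ θ' M M') {j : ℕ} (hA : A ≤ j)
    (hB : j + 2 ≤ B) (hj : ¬green j) (hj1 : green (j + 1)) :
    0 ≤ poleSide (M j * boost (l j)) ∧ 0 ≤ poleSide (M' j * boost (l j)) := by
  have w := h.arc.window_nonneg hA (by omega)
  have w' := h.arc'.window_nonneg hA (by omega)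
  have v := h.arc.window_nonneg (j := j + 2) (by omega) hB
  have v' := h.arc'.window_nonneg (j := j + 2) (by omega) hB
  rw [h.chain.two_step hj1] at v
  rw [h.chain'.two_step hj1, ← h.length_eq j hj] at v'
  constructor
  · refine HypPlane.poleSide_nonneg (h.chain.length_pos _) ?_ ?_ v.1 v.2
    · rw [mul_boost_00]; exact mul_nonneg w.1 (Real.exp_pos _).le
    · rw [mul_boost_11]; exact mul_nonneg w.2 (Real.exp_pos _).le
  · refine HypPlane.poleSide_nonneg (h.chain'.length_pos _) ?_ ?_ v'.1 v'.2
    · rw [mul_boost_00]; exact mul_nonneg w'.1 (Real.exp_pos _).le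
    · rw [mul_boost_11]; exact mul_nonneg w'.2 (Real.exp_pos _).le

/-- After multiplication by the positive denominators each increment is one of the Wronskians, a
product of nonnegative factors. -/
theorem ratio_mono (h : IsArmPair green A B l l' θ θ' M M') {i j : ℕ} (hi : A ≤ i) (hij : i ≤ j)
    (hj : j ≤ B) (hib : ¬green i) (hjb : ¬green j) :
    cross (M i) (M' i) / cross (M' i) (M i) ≤ cross (M j) (M' j) / cross (M' j) (M j) := by
  refine black_induction h.chain.isolated (p := fun j => j ≤ B →
    cross (M i) (M' i) / cross (M' i) (M i) ≤ cross (M j) (M' j) / cross (M' j) (M j))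
    hib (fun _ => le_rfl) ?_ ?_ j hij hjb hj
  · intro k hk hkb hkb1 ih hB
    refine (ih (by omega)).trans ?_
    rw [div_le_div_iff₀ (h.cross_pos (by omega) (by omega) hkb)
      (h.cross_pos (by omega) (by omega) hkb1)]
    have e := h.angle_sub hkb
    have e1 := mul_nonneg (h.sin_nonneg (by omega) (by omega) hkb hkb1)
      (add_nonneg (h.arc.side (k + 1) (by omega) (by omega))
        (h.arc'.side (k + 1) (by omega) (by omega)))
    linarith
  · intro k hk hkb hkb1 hkb2 ih hB
    refine (ih (by omega)).trans ?_
    rw [div_le_div_iff₀ (h.cross_pos (by omega) (by omega) hkb)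
      (h.cross_pos (by omega) (by omega) hkb2)]
    have e := h.detour_sub hkb hkb1
    have hp := h.poleSide_nonneg (by omega) hB hkb hkb1
    have hs : 0 ≤ Real.sinh ((l (k + 1) - l' (k + 1)) / 2) :=
      Real.sinh_nonneg_iff.2 (by linarith [h.length_le k (by omega) (by omega) hkb1])
    have e1 := mul_nonneg hs (add_nonneg hp.1 hp.2)
    linarith

/-- The arm lemma, where an angle is strictly larger. -/
theorem ratio_lt_of_angle (h : IsArmPair green A B l l' θ θ' M M') {j : ℕ} (hA : A ≤ j)
    (hB : j < B) (hj : ¬green j) (hj1 : ¬green (j + 1)) (hlt : θ' (j + 1) < θ (j + 1))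
    (hs : 0 < HypPlane.side (M (j + 1))) :
    cross (M A) (M' A) / cross (M' A) (M A) < cross (M B) (M' B) / cross (M' B) (M B) := by
  refine (h.ratio_mono le_rfl hA hB.le h.black_left hj).trans_lt
    (lt_of_lt_of_le ?_ (h.ratio_mono (by omega) hB le_rfl hj1 h.black_right))
  rw [div_lt_div_iff₀ (h.cross_pos (by omega) (by omega) hj)
    (h.cross_pos (by omega) (by omega) hj1)]
  have e := h.angle_sub hj
  have h2 := h.chain.angle_lt (j + 1)
  have h3 := h.chain'.angle_pos (j + 1)
  have e1 : 0 < Real.sin ((θ (j + 1) - θ' (j + 1)) / 2) :=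
    Real.sin_pos_of_pos_of_lt_pi (by linarith) (by linarith)
  have e2 := mul_pos e1 (add_pos_of_pos_of_nonneg hs (h.arc'.side (j + 1) (by omega) (by omega)))
  linarith

/-- The arm lemma, where a green edge is strictly longer. -/
theorem ratio_lt_of_length (h : IsArmPair green A B l l' θ θ' M M') {j : ℕ} (hA : A ≤ j)
    (hB : j + 2 ≤ B) (hj1 : green (j + 1)) (hlt : l' (j + 1) < l (j + 1))
    (hw : 0 < M j 0 0 ∧ 0 < M j 1 1) (hw2 : 0 < M (j + 2) 0 0 ∧ 0 < M (j + 2) 1 1) :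
    cross (M A) (M' A) / cross (M' A) (M A) < cross (M B) (M' B) / cross (M' B) (M B) := by
  have hj : ¬green j := fun hj => h.chain.isolated j hj hj1
  have hj2 : ¬green (j + 2) := h.chain.isolated _ hj1
  refine (h.ratio_mono le_rfl hA (by omega) h.black_left hj).trans_lt
    (lt_of_lt_of_le ?_ (h.ratio_mono (by omega) hB le_rfl hj2 h.black_right))
  rw [div_lt_div_iff₀ (h.cross_pos (by omega) (by omega) hj)
    (h.cross_pos (by omega) (by omega) hj2)]
  have e := h.detour_sub hj hj1
  have hp := h.poleSide_nonneg hA hB hj hj1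
  have hs : 0 < Real.sinh ((l (j + 1) - l' (j + 1)) / 2) := Real.sinh_pos_iff.2 (by linarith)
  have hpos : 0 < poleSide (M j * boost (l j)) := by
    rw [h.chain.two_step hj1] at hw2
    refine poleSide_pos (h.chain.length_pos _) ?_ ?_ hw2.1 hw2.2
    · rw [mul_boost_00]; exact mul_pos hw.1 (Real.exp_pos _)
    · rw [mul_boost_11]; exact mul_pos hw.2 (Real.exp_pos _)
  have e2 := mul_pos hs (add_pos_of_pos_of_nonneg hpos hp.2)
  linarith

end IsArmPair

/-! ### Sign conditions on the diagonal entries from convexity. -/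

/-- Up to a positive factor, the signed distance of the point `boost D • I` from the edge of the
frame `M`; it is positive on the left. -/
noncomputable def far (D : ℝ) (M : SL(2, ℝ)) : ℝ :=
  M 0 0 * M 0 1 * Real.exp (-D) + M 1 0 * M 1 1 * Real.exp D

theorem far_mul_boost (D : ℝ) (M : SL(2, ℝ)) (t : ℝ) : far D (M * boost t) = far D M := by
  unfold far
  rw [mul_boost_00, mul_boost_01, mul_boost_10, mul_boost_11]
  linear_combination (M 0 0 * M 0 1 * Real.exp (-D) + M 1 0 * M 1 1 * Real.exp D) * exp_half_mul t

theorem orient_far (g c : SL(2, ℝ)) (t D : ℝ) :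
    orient (g • I) ((g * boost t) • I) ((c * boost D) • I) = far D (c⁻¹ * g) * (2 * Real.sinh t) := by
  rw [orient_frame]
  have h : g⁻¹ * (c * boost D) = (c⁻¹ * g)⁻¹ * boost D := by group
  rw [h]
  obtain ⟨h00, h01, h10, h11⟩ := inv_entries (c⁻¹ * g)
  unfold side far
  rw [mul_boost_00, mul_boost_01, mul_boost_10, mul_boost_11, h00, h01, h10, h11,
    ← exp_half_sq D, ← exp_neg_half_sq D]
  ring

/-- Otherwise the line of the edge would be disjoint from the axis and directed against it. Its base
point being to the right of the axis, the whole axis would lie strictly to the right of the edge,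
against `hf`. -/
theorem window_mul_pos {D : ℝ} {M : SL(2, ℝ)} (hs : 0 < side M) (hf : 0 ≤ far D M) :
    0 < M 0 0 * M 1 1 := by
  have hd := sl_det M
  unfold side at hs
  unfold far at hf
  have hE := Real.exp_pos D
  have hE' := Real.exp_pos (-D)
  by_contra hn
  push Not at hn
  have h1 : M 0 1 * M 1 0 < 0 := by linarith
  have h2 : 0 ≤ (M 0 0 * M 0 1) * Real.exp (-D) * Real.exp D + M 1 0 * M 1 1 * Real.exp D ^ 2 := by
    nlinarith
  rw [mul_assoc, ← Real.exp_add, neg_add_cancel, Real.exp_zero, mul_one] at h2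
  rcases lt_or_gt_of_ne (left_ne_zero_of_mul h1.ne) with h01 | h01
  · have h10 : 0 < M 1 0 := by nlinarith
    have : 0 < M 0 0 ∨ M 1 1 < 0 := by
      by_contra h
      push Not at h
      nlinarith [mul_nonneg (neg_nonneg.2 h.1) h10.le, mul_nonneg (neg_nonneg.2 h01.le) h.2]
    rcases this with h | h
    · have h11 : M 1 1 ≤ 0 := by nlinarith
      nlinarith [mul_pos h (neg_pos.2 h01), mul_nonneg (mul_nonneg h10.le (neg_nonneg.2 h11)) (sq_nonneg (Real.exp D))]
    · have h00 : 0 ≤ M 0 0 := by nlinarith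
      have := mul_pos (mul_pos h10 (neg_pos.2 h)) (pow_pos hE 2)
      nlinarith [mul_nonneg h00 (neg_nonneg.2 h01.le)]
  · have h10 : M 1 0 < 0 := by nlinarith
    have : M 0 0 < 0 ∨ 0 < M 1 1 := by
      by_contra h
      push Not at h
      nlinarith [mul_nonneg h.1 (neg_nonneg.2 h10.le), mul_nonneg h01.le (neg_nonneg.2 h.2)]
    rcases this with h | h
    · have h11 : 0 ≤ M 1 1 := by nlinarith
      nlinarith [mul_pos (neg_pos.2 h) h01, mul_nonneg (mul_nonneg (neg_nonneg.2 h10.le) h11) (sq_nonneg (Real.exp D))]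
    · have h00 : M 0 0 ≤ 0 := by nlinarith
      have := mul_pos (mul_pos (neg_pos.2 h10) h) (pow_pos hE 2)
      nlinarith [mul_nonneg (neg_nonneg.2 h00) h01.le]

/-- Only the lift is at issue: the product of the diagonal entries is positive by `window_mul_pos`,
and a turn by less than `π` cannot make both negative while the far end of the chord stays to the
left of both edges. -/
theorem window_turn {D θ : ℝ} {M : SL(2, ℝ)} (h0 : 0 < θ) (hpi : θ < Real.pi)
    (hw : 0 < M 0 0 ∧ 0 < M 1 1) (hs : 0 < side M) (hf : 0 ≤ far D M)
    (hf' : 0 ≤ far D (M * turn θ)) : 0 < (M * turn θ) 0 0 ∧ 0 < (M * turn θ) 1 1 := by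
  have hs' : 0 < side (M * turn θ) := by rwa [side_mul_turn]
  have hp := window_mul_pos hs' hf'
  rcases pos_and_pos_or_neg_and_neg_of_mul_pos hp with h | ⟨hn0, hn1⟩
  · exact h
  exfalso
  have hd := sl_det M
  have ht := half_angle_pos h0 hpi
  have e1 := Real.sin_sq_add_cos_sq (θ / 2)
  have h10' : (M * turn θ) 1 0 < 0 := by
    rw [mul_turn_11] at hn1
    rw [mul_turn_10]
    have : M 1 0 < 0 := by
      by_contra h
      push Not at h
      nlinarith [mul_nonneg h ht.2.le, mul_pos hw.2 ht.1]
    nlinarith [mul_pos hw.2 ht.2, mul_pos (neg_pos.2 this) ht.1]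
  have h10 : M 1 0 < 0 := by
    rw [mul_turn_11] at hn1
    by_contra h
    push Not at h
    nlinarith [mul_nonneg h ht.2.le, mul_pos hw.2 ht.1]
  -- eliminate the exponentials from the two conditions on `far`
  have key : far D M * ((M * turn θ) 1 0 * (M * turn θ) 1 1) - far D (M * turn θ) * (M 1 0 * M 1 1)
      = -(Real.sin (θ / 2) * Real.cos (θ / 2) * side M) * Real.exp (-D) := by
    unfold far side
    rw [mul_turn_00, mul_turn_01, mul_turn_10, mul_turn_11]
    linear_combination (-(Real.sin (θ / 2) * Real.cos (θ / 2)
      * (M 0 0 * M 1 0 + M 0 1 * M 1 1)) * Real.exp (-D)) * hd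
  have k1 := mul_nonneg hf (mul_pos_of_neg_of_neg h10' hn1).le
  have k2 := mul_nonneg hf' (mul_pos (neg_pos.2 h10) hw.2).le
  have k3 := mul_pos (mul_pos (mul_pos ht.1 ht.2) hs) (Real.exp_pos (-D))
  linarith

theorem IsFrameChain.window {green : ℕ → Prop} {l θ : ℕ → ℝ} {M : ℕ → SL(2, ℝ)}
    (h : IsFrameChain green l θ M) {A B : ℕ} {D : ℝ} (hA : 0 < M A 0 0 ∧ 0 < M A 1 1)
    (hs : ∀ j, A < j → j ≤ B → 0 < side (M j)) (hf : ∀ j, A ≤ j → j ≤ B → 0 ≤ far D (M j))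
    (j : ℕ) (hAj : A ≤ j) (hjB : j ≤ B) : 0 < M j 0 0 ∧ 0 < M j 1 1 := by
  induction j, hAj using Nat.le_induction with
  | base => exact hA
  | succ j hj ih =>
    have w := ih (by omega)
    have s := hs (j + 1) (by omega) hjB
    have f := hf (j + 1) (by omega) hjB
    rw [h.step] at s f ⊢
    rw [side_mul_turn] at s
    refine window_turn (h.angle_pos _) (h.angle_lt _) ?_ s
      (by rw [far_mul_boost]; exact hf j hj (by omega)) f
    rw [mul_boost_00, mul_boost_11]
    exact ⟨mul_pos w.1 (Real.exp_pos _), mul_pos w.2 (Real.exp_pos _)⟩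

theorem IsFrameChain.mul_left {green : ℕ → Prop} {l θ : ℕ → ℝ} {M : ℕ → SL(2, ℝ)}
    (h : IsFrameChain green l θ M) (g : SL(2, ℝ)) : IsFrameChain green l θ fun j => g * M j where
  step j := by rw [h.step]; group
  length_pos := h.length_pos
  angle_pos := h.angle_pos
  angle_lt := h.angle_lt
  right := h.right
  isolated := h.isolated

end HypPlane

/-! ### Periodic indexing, convex position and the frames of a polygon. -/

namespace GreenBlackPolygon

open HypPlane

variable {n : ℕ} [NeZero n] (P : GreenBlackPolygon n)

/-- The vertices, indexed periodically by the natural numbers. -/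
def vtx (j : ℕ) : ℍ := P.vertex (Fin.ofNat n j)

/-- The lengths of the edges, indexed periodically by the natural numbers. -/
noncomputable def len (j : ℕ) : ℝ := P.edgeLength (Fin.ofNat n j)

/-- The interior angles, indexed periodically by the natural numbers. -/
noncomputable def ang (j : ℕ) : ℝ := P.interiorAngle (Fin.ofNat n j)

/-- The edge with a given index is green. -/
def IsGreen (j : ℕ) : Prop := P.edgeColor (Fin.ofNat n j) = GBColor.green

theorem gbColor_ne_green_iff {c : GBColor} : c ≠ GBColor.green ↔ c = GBColor.black := by
  cases c <;> simp

theorem ofNat_succ (j : ℕ) : Fin.ofNat n (j + 1) = Fin.ofNat n j + 1 := by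
  apply Fin.ext
  simp [Fin.val_add]

theorem ofNat_succ_sub (j : ℕ) : Fin.ofNat n (j + 1) - 1 = Fin.ofNat n j := by
  rw [ofNat_succ, add_sub_cancel_right]

theorem ofNat_add_period (j : ℕ) : Fin.ofNat n (j + n) = Fin.ofNat n j := by
  apply Fin.ext
  simp

theorem ofNat_ne {i j : ℕ} (h : i < j) (h' : j < i + n) : Fin.ofNat n j ≠ Fin.ofNat n i := by
  intro he
  have h1 : j % n = i % n := congrArg Fin.val he
  have h2 : n ∣ j - i := (Nat.modEq_iff_dvd' h.le).1 h1.symm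
  have := Nat.le_of_dvd (by omega) h2
  omega

theorem vtx_period (j : ℕ) : P.vtx (j + n) = P.vtx j := by
  unfold vtx; rw [ofNat_add_period]

theorem len_period (j : ℕ) : P.len (j + n) = P.len j := by
  unfold len; rw [ofNat_add_period]

theorem ang_period (j : ℕ) : P.ang (j + n) = P.ang j := by
  unfold ang; rw [ofNat_add_period]

theorem isGreen_period (j : ℕ) : P.IsGreen (j + n) ↔ P.IsGreen j := by
  unfold IsGreen; rw [ofNat_add_period]

theorem len_eq (j : ℕ) : P.len j = dist (P.vtx j) (P.vtx (j + 1)) := by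
  unfold len vtx edgeLength; rw [ofNat_succ]

theorem ang_eq (j : ℕ) : P.ang (j + 1) = hypAngle (P.vtx j) (P.vtx (j + 1)) (P.vtx (j + 2)) := by
  unfold ang vtx interiorAngle
  rw [ofNat_succ_sub, ofNat_succ (j + 1)]

theorem strictlyLeft {i j : ℕ} (h : i + 1 < j) (h' : j < i + n) :
    StrictlyLeft (P.vtx i) (P.vtx (i + 1)) (P.vtx j) := by
  have := P.convex (Fin.ofNat n i) (Fin.ofNat n j) (ofNat_ne (by omega) h')
    (by rw [← ofNat_succ]; exact ofNat_ne h (by omega))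
  rwa [← ofNat_succ] at this

theorem orient_edge_pos {i j : ℕ} (h : i + 1 < j) (h' : j < i + n) :
    0 < orient (P.vtx i) (P.vtx (i + 1)) (P.vtx j) :=
  (strictlyLeft_iff _ _ _).1 (P.strictlyLeft h h')

end GreenBlackPolygon

namespace HypPlane

theorem orient_rotate (a b c : ℍ) : orient b c a = orient a b c := by
  unfold orient; ring

theorem orient_swap (a b c : ℍ) : orient a c b = -orient a b c := by
  unfold orient; ring

theorem orient_self_left (a b : ℍ) : orient a a b = 0 := by
  unfold orient; ring

theorem orient_self_right (a b : ℍ) : orient a b b = 0 := by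
  unfold orient; ring

theorem orient_self_outer (a b : ℍ) : orient a b a = 0 := by
  unfold orient; ring

/-- The three-term Plücker relation; it advances the last vertex by one in the induction for convex
position. -/
theorem orient_pluecker (o e a b c : ℍ) :
    orient o e b * orient o a c = orient o e a * orient o b c + orient o e c * orient o a b := by
  unfold orient; ring

end HypPlane

namespace GreenBlackPolygon

open HypPlane

variable {n : ℕ} [NeZero n] (P : GreenBlackPolygon n)

/-- The vertices of a convex polygon are in convex position. -/
theorem orient_pos {i j k : ℕ} (hij : i < j) (hjk : j < k) (hk : k < i + n) :
    0 < orient (P.vtx i) (P.vtx j) (P.vtx k) := by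
  rcases (Nat.succ_le_of_lt hij).eq_or_lt with rfl | hij'
  · exact P.orient_edge_pos hjk hk
  induction k, Nat.succ_le_of_lt hjk using Nat.le_induction with
  | base =>
    have h := P.orient_edge_pos (i := j) (j := i + n) hk (by omega)
    rw [vtx_period] at h
    rwa [← orient_rotate]
  | succ k hk' ih =>
    have h1 := ih (by omega) (by omega)
    have e := orient_pluecker (P.vtx i) (P.vtx (i + 1)) (P.vtx j) (P.vtx k) (P.vtx (k + 1))
    have h2 := P.orient_edge_pos (i := k) (j := i + n) hk (by omega)
    rw [vtx_period] at h2
    rw [orient_rotate] at h2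
    have h3 := P.orient_edge_pos (i := i) (j := j) (by omega) (by omega)
    have h4 := P.orient_edge_pos (i := i) (j := k) (by omega) (by omega)
    have h5 := P.orient_edge_pos (i := i) (j := k + 1) (by omega) (by omega)
    have : 0 < orient (P.vtx i) (P.vtx (i + 1)) (P.vtx k) * orient (P.vtx i) (P.vtx j) (P.vtx (k + 1)) := by
      rw [e]; positivity
    exact pos_of_mul_pos_right this h4.le

theorem orient_nonneg {i j k : ℕ} (hij : i ≤ j) (hjk : j ≤ k) (hk : k ≤ i + n) :
    0 ≤ orient (P.vtx i) (P.vtx j) (P.vtx k) := by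
  rcases hij.eq_or_lt with rfl | hij
  · rw [orient_self_left]
  rcases hjk.eq_or_lt with rfl | hjk
  · rw [orient_self_right]
  rcases hk.eq_or_lt with rfl | hk
  · rw [vtx_period, orient_self_outer]
  exact (P.orient_pos hij hjk hk).le

theorem len_pos (j : ℕ) : 0 < P.len j := by
  rw [len_eq, dist_pos]
  intro h
  have h3 := P.three_le
  have := P.orient_edge_pos (i := j) (j := j + 2) (by omega) (by omega)
  rw [← h, orient_self_left] at this
  exact lt_irrefl _ this

theorem isolated (j : ℕ) (h : P.IsGreen j) : ¬P.IsGreen (j + 1) := by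
  have := (P.green_edge_adjacent _ h).2
  unfold IsGreen
  rw [ofNat_succ, this]
  simp

theorem isolated' (j : ℕ) (h : P.IsGreen (j + 1)) : ¬P.IsGreen j := fun h' => P.isolated j h' h

theorem exists_frames : ∃ S : ℕ → SL(2, ℝ), IsFrameChain P.IsGreen P.len P.ang S ∧
    (∀ j, S j • I = P.vtx j) ∧ ∀ j, (S j * boost (P.len j)) • I = P.vtx (j + 1) := by
  have h3 := P.three_le
  obtain ⟨g, hg, hg'⟩ := exists_frame (P.vtx 0) (P.vtx 1)
  let S : ℕ → SL(2, ℝ) := fun j => Nat.rec g (fun j M => M * boost (P.len j) * turn (P.ang (j + 1))) j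
  have hS : ∀ j, S (j + 1) = S j * boost (P.len j) * turn (P.ang (j + 1)) := fun _ => rfl
  have hV : ∀ j, S j • I = P.vtx j ∧ (S j * boost (P.len j)) • I = P.vtx (j + 1) := by
    intro j
    induction j with
    | zero => exact ⟨hg, by rw [len_eq]; exact hg'⟩
    | succ j ih =>
      constructor
      · rw [hS, mul_smul, turn_smul_I, ih.2]
      · rw [hS]
        have h := ih.2
        rw [len_eq] at h
        have := (frame_next ih.1 h (P.strictlyLeft (i := j) (j := j + 2) (by omega) (by omega))).1
        rwa [← ang_eq, ← len_eq, ← len_eq] at this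
  have hang1 : ∀ j, 0 < P.ang (j + 1) ∧ P.ang (j + 1) < Real.pi := by
    intro j
    have h := (hV j).2
    rw [len_eq] at h
    have := (frame_next (hV j).1 h (P.strictlyLeft (i := j) (j := j + 2) (by omega) (by omega))).2
    rwa [← ang_eq] at this
  -- The corner at index zero has no predecessor in `ℕ`; it is reached through periodicity.
  have hang : ∀ j, 0 < P.ang j ∧ P.ang j < Real.pi := by
    intro j
    have := hang1 (j + n - 1)
    rwa [show j + n - 1 + 1 = j + n by omega, ang_period] at this
  refine ⟨S, ⟨hS, P.len_pos, fun j => (hang j).1, fun j => (hang j).2, ?_, P.isolated⟩,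
    fun j => (hV j).1, fun j => (hV j).2⟩
  intro j hj
  have ha := P.green_edge_adjacent _ hj
  constructor
  · unfold ang interiorAngle
    apply P.orthogonal
    rw [ha.1, hj]
    simp
  · unfold ang interiorAngle
    rw [ofNat_succ]
    apply P.orthogonal
    rw [add_sub_cancel_right, ha.2, hj]
    simp

end GreenBlackPolygon

/-! ### Midpoints of edges and the frame of a chord. -/

namespace HypPlane

theorem sl_neg_smul (g : SL(2, ℝ)) (z : ℍ) : (-g) • z = g • z := by
  apply ext_coord
  · rw [coordA_smul, coordA_smul]; simp
  · rw [coordB_smul, coordB_smul]; simp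

/-- The stabiliser of `I` is the rotation group: both rows are unit vectors and the determinant is
one, so the squares of the two differences add up to zero. -/
theorem entries_of_fix_I {K : SL(2, ℝ)} (h : K • I = I) : K 1 1 = K 0 0 ∧ K 1 0 = -K 0 1 := by
  have hA := coordA_smul_I K
  have hC := coordC_smul_I K
  rw [h, coord_I.1] at hA
  rw [h, coord_I.2.2] at hC
  have hd := sl_det K
  constructor <;> nlinarith [sq_nonneg (K 0 0 - K 1 1), sq_nonneg (K 0 1 + K 1 0)]

/-- On the hyperboloid a midpoint is the normalised sum of the endpoints, so orientations involving
it reduce to orientations of vertices. -/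
theorem coord_midpoint (g : SL(2, ℝ)) (t : ℝ) :
    coordA ((g * boost (t / 2)) • I) * (2 * Real.cosh (t / 2))
      = coordA (g • I) + coordA ((g * boost t) • I) ∧
    coordB ((g * boost (t / 2)) • I) * (2 * Real.cosh (t / 2))
      = coordB (g • I) + coordB ((g * boost t) • I) ∧
    coordC ((g * boost (t / 2)) • I) * (2 * Real.cosh (t / 2))
      = coordC (g • I) + coordC ((g * boost t) • I) := by
  have e := exp_half_mul t
  have e1 := exp_half_sq t
  have e2 := exp_neg_half_sq t
  simp only [mul_smul]
  simp only [coordA_smul g, coordB_smul g, coordC_smul g, coord_I.1, coord_I.2.1, coord_I.2.2,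
    (coord_boost _).1, (coord_boost _).2.1, (coord_boost _).2.2, Real.cosh_eq, ← e1, ← e2]
  refine ⟨?_, ?_, ?_⟩
  · linear_combination (g 1 0 ^ 2 + g 1 1 ^ 2) * e
  · linear_combination (g 0 0 * g 1 0 + g 0 1 * g 1 1) * e
  · linear_combination (g 0 0 ^ 2 + g 0 1 ^ 2) * e

theorem orient_midpoint (g : SL(2, ℝ)) (t : ℝ) (b c : ℍ) :
    orient b c ((g * boost (t / 2)) • I) * (2 * Real.cosh (t / 2))
      = orient b c (g • I) + orient b c ((g * boost t) • I) := by
  obtain ⟨hA, hB, hC⟩ := coord_midpoint g t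
  unfold orient
  linear_combination (coordB b * coordC c - coordC b * coordB c) * hA
    - (coordA b * coordC c - coordC b * coordA c) * hB
    + (coordA b * coordB c - coordB b * coordA c) * hC

end HypPlane

namespace GreenBlackPolygon

open HypPlane

variable {n : ℕ} [NeZero n] (P : GreenBlackPolygon n)

/-- The frames at the starts of the edges of a polygon. -/
structure IsFrames (S : ℕ → SL(2, ℝ)) : Prop where
  chain : IsFrameChain P.IsGreen P.len P.ang S
  start : ∀ j, S j • I = P.vtx j
  finish : ∀ j, (S j * boost (P.len j)) • I = P.vtx (j + 1)

/-- The midpoint of an edge. -/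
noncomputable def mid (S : ℕ → SL(2, ℝ)) (j : ℕ) : ℍ := (S j * boost (P.len j / 2)) • I

variable {P}

theorem IsFrames.orient_mid {S : ℕ → SL(2, ℝ)} (hS : P.IsFrames S) (b c : ℍ) (j : ℕ) :
    orient b c (P.mid S j) * (2 * Real.cosh (P.len j / 2))
      = orient b c (P.vtx j) + orient b c (P.vtx (j + 1)) := by
  unfold mid
  rw [orient_midpoint, hS.start, hS.finish]

theorem IsFrames.mid_period {S : ℕ → SL(2, ℝ)} (hS : P.IsFrames S) (j : ℕ) :
    P.mid S (j + n) = P.mid S j := by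
  have h0 : 2 * Real.cosh (P.len j / 2) ≠ 0 := by positivity
  have h1 := coord_midpoint (S (j + n)) (P.len (j + n))
  have h2 := coord_midpoint (S j) (P.len j)
  rw [hS.start, hS.finish, show j + n + 1 = j + 1 + n by omega, vtx_period, vtx_period, len_period] at h1
  rw [hS.start, hS.finish] at h2
  unfold mid
  rw [len_period]
  apply ext_coord
  · exact mul_right_cancel₀ h0 (h1.1.trans h2.1.symm)
  · exact mul_right_cancel₀ h0 (h1.2.1.trans h2.2.1.symm)

/-- Expanding both midpoints gives four orientations of vertices in cyclic order: none is negative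
and at least one is positive. -/
theorem IsFrames.orient_chord_pos {S : ℕ → SL(2, ℝ)} (hS : P.IsFrames S) {A B j : ℕ} (hA : A < j)
    (hB : j ≤ B) (hn : B < A + n) : 0 < orient (P.mid S A) (P.vtx j) (P.mid S B) := by
  have h3 := P.three_le
  have c1 : 0 < 2 * Real.cosh (P.len A / 2) := by positivity
  have c2 : 0 < 2 * Real.cosh (P.len B / 2) := by positivity
  have e : orient (P.mid S A) (P.vtx j) (P.mid S B) * (2 * Real.cosh (P.len A / 2))
      * (2 * Real.cosh (P.len B / 2))
      = orient (P.vtx A) (P.vtx j) (P.vtx B) + orient (P.vtx A) (P.vtx j) (P.vtx (B + 1))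
        + (orient (P.vtx (A + 1)) (P.vtx j) (P.vtx B)
          + orient (P.vtx (A + 1)) (P.vtx j) (P.vtx (B + 1))) := by
    have e1 := hS.orient_mid (P.mid S A) (P.vtx j) B
    have e2 := hS.orient_mid (P.vtx j) (P.vtx B) A
    have e3 := hS.orient_mid (P.vtx j) (P.vtx (B + 1)) A
    simp only [orient_rotate (P.mid S A), orient_rotate (P.vtx A), orient_rotate (P.vtx (A + 1))] at e2 e3
    linear_combination (2 * Real.cosh (P.len A / 2)) * e1 + e2 + e3
  have n1 := P.orient_nonneg (i := A) (j := j) (k := B) (by omega) (by omega) (by omega)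
  have n2 := P.orient_nonneg (i := A) (j := j) (k := B + 1) (by omega) (by omega) (by omega)
  have n3 := P.orient_nonneg (i := A + 1) (j := j) (k := B) (by omega) (by omega) (by omega)
  have n4 := P.orient_nonneg (i := A + 1) (j := j) (k := B + 1) (by omega) (by omega) (by omega)
  have hpos : 0 < orient (P.vtx A) (P.vtx j) (P.vtx B) + orient (P.vtx A) (P.vtx j) (P.vtx (B + 1))
        + (orient (P.vtx (A + 1)) (P.vtx j) (P.vtx B)
          + orient (P.vtx (A + 1)) (P.vtx j) (P.vtx (B + 1))) := by
    rcases hB.eq_or_lt with rfl | hB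
    · rcases (Nat.succ_le_of_lt hA).eq_or_lt with rfl | hA
      · linarith [P.orient_pos (i := A) (j := A + 1) (k := A + 1 + 1) (by omega) (by omega) (by omega)]
      · linarith [P.orient_pos (i := A + 1) (j := j) (k := j + 1) (by omega) (by omega) (by omega)]
    · linarith [P.orient_pos (i := A) (j := j) (k := B) (by omega) (by omega) (by omega)]
  rw [← e] at hpos
  exact pos_of_mul_pos_left (pos_of_mul_pos_left hpos c2.le) c1.le

theorem IsFrames.orient_edge_mid_nonneg {S : ℕ → SL(2, ℝ)} (hS : P.IsFrames S) {j k : ℕ}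
    (hj : j ≤ k) (hk : k < j + n) : 0 ≤ orient (P.vtx j) (P.vtx (j + 1)) (P.mid S k) := by
  have c : 0 < 2 * Real.cosh (P.len k / 2) := by positivity
  have e := hS.orient_mid (P.vtx j) (P.vtx (j + 1)) k
  have h : 0 ≤ orient (P.vtx j) (P.vtx (j + 1)) (P.vtx k)
      + orient (P.vtx j) (P.vtx (j + 1)) (P.vtx (k + 1)) := by
    rcases hj.eq_or_lt with rfl | hj
    · rw [orient_self_outer, orient_self_right, add_zero]
    · exact add_nonneg (P.orient_nonneg (by omega) (by omega) (by omega))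
        (P.orient_nonneg (by omega) (by omega) (by omega))
  rw [← e] at h
  exact nonneg_of_mul_nonneg_left h c

/-- The frames along an arc of a polygon, seen from the chord between the midpoints of two edges. -/
theorem IsFrames.exists_chord {S : ℕ → SL(2, ℝ)} (hS : P.IsFrames S) {A B : ℕ} (hAB : A < B)
    (hn : B < A + n) : ∃ c : SL(2, ℝ),
      (∀ j, A ≤ j → j ≤ B → 0 < (c * S j) 0 0 ∧ 0 < (c * S j) 1 1) ∧
      (∀ j, A < j → j ≤ B → 0 < side (c * S j)) ∧
      (∃ x y : ℝ, 0 < x ∧ y ≤ 0 ∧ (c * S A * boost (P.len A / 2)) 0 0 = x ∧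
        (c * S A * boost (P.len A / 2)) 0 1 = y ∧ (c * S A * boost (P.len A / 2)) 1 0 = -y ∧
        (c * S A * boost (P.len A / 2)) 1 1 = x) ∧
      (∃ x y : ℝ, 0 < x ∧ 0 ≤ y ∧
        (c * S B * boost (P.len B / 2)) 0 0 = Real.exp (dist (P.mid S A) (P.mid S B) / 2) * x ∧
        (c * S B * boost (P.len B / 2)) 0 1 = Real.exp (dist (P.mid S A) (P.mid S B) / 2) * y ∧
        (c * S B * boost (P.len B / 2)) 1 0 = -(Real.exp (-(dist (P.mid S A) (P.mid S B) / 2)) * y) ∧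
        (c * S B * boost (P.len B / 2)) 1 1 = Real.exp (-(dist (P.mid S A) (P.mid S B) / 2)) * x) := by
  set D := dist (P.mid S A) (P.mid S B) with hD
  obtain ⟨g, hga, hgb⟩ := exists_frame (P.mid S A) (P.mid S B)
  rw [← hD] at hgb
  -- choose the lift of the chord frame
  obtain ⟨c, hca, hcb, hc0⟩ : ∃ c : SL(2, ℝ), c • I = P.mid S A ∧ (c * boost D) • I = P.mid S B ∧
      0 ≤ (c⁻¹ * S A) 0 0 := by
    rcases le_total 0 ((g⁻¹ * S A) 0 0) with h | h
    · exact ⟨g, hga, hgb, h⟩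
    · refine ⟨-g, by rw [sl_neg_smul, hga], by rw [neg_mul, sl_neg_smul, hgb], ?_⟩
      have : (-g)⁻¹ = -g⁻¹ := by
        rw [inv_eq_iff_mul_eq_one]; simp
      rw [this, neg_mul]
      simpa using h
  have hside : ∀ j, A < j → j ≤ B → 0 < side (c⁻¹ * S j) * (2 * Real.sinh D) := by
    intro j h1 h2
    have e := orient_frame c (S j) D
    rw [hca, hcb, hS.start, orient_swap] at e
    linarith [hS.orient_chord_pos h1 h2 hn]
  have hsD : 0 < 2 * Real.sinh D := by
    have h0 : 0 ≤ 2 * Real.sinh D := mul_nonneg (by norm_num) (Real.sinh_nonneg_iff.2 dist_nonneg)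
    rcases h0.eq_or_lt with h | h
    · have := hside B hAB le_rfl
      rw [← h] at this
      simp at this
    · exact h
  have hside' : ∀ j, A < j → j ≤ B → 0 < side (c⁻¹ * S j) := fun j h1 h2 =>
    pos_of_mul_pos_left (hside j h1 h2) hsD.le
  have hsl : ∀ j, 0 < 2 * Real.sinh (P.len j) := fun j =>
    mul_pos (by norm_num) (Real.sinh_pos_iff.2 (P.len_pos j))
  have hfar : ∀ j, A ≤ j → j ≤ B → 0 ≤ far D (c⁻¹ * S j) := by
    intro j h1 h2
    have e := orient_far (S j) c (P.len j) D
    rw [hcb, hS.start, hS.finish] at e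
    have := hS.orient_edge_mid_nonneg h2 (by omega)
    rw [e] at this
    exact nonneg_of_mul_nonneg_left this (hsl j)
  -- The near end of the chord, seen from edge `B`, is the midpoint of edge `A + n`, which comes
  -- after `B`.
  have hfar0 : 0 ≤ far 0 (c⁻¹ * S B) := by
    have e := orient_far (S B) c (P.len B) 0
    rw [boost_zero, mul_one, hca, hS.start, hS.finish] at e
    have := hS.orient_edge_mid_nonneg (j := B) (k := A + n) (by omega) (by omega)
    rw [hS.mid_period, e] at this
    exact nonneg_of_mul_nonneg_left this (hsl B)
  -- Vertex `A` is not known to lie to the right of the chord, so the criterion is applied at the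
  -- other end of edge `A`.
  have hwA : 0 < (c⁻¹ * S A) 0 0 ∧ 0 < (c⁻¹ * S A) 1 1 := by
    have hs := hside' (A + 1) (by omega) (by omega)
    have e := hS.chain.step A
    rw [e, ← mul_assoc, ← mul_assoc, side_mul_turn] at hs
    have := window_mul_pos hs (by rw [far_mul_boost]; exact hfar A le_rfl hAB.le)
    rw [mul_boost_00, mul_boost_11] at this
    have h2 : 0 < (c⁻¹ * S A) 0 0 * (c⁻¹ * S A) 1 1 := by
      have e2 := exp_half_mul (P.len A)
      nlinarith
    have h3 : 0 < (c⁻¹ * S A) 0 0 := lt_of_le_of_ne hc0 (left_ne_zero_of_mul h2.ne').symm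
    exact ⟨h3, pos_of_mul_pos_right h2 h3.le⟩
  have hw := (hS.chain.mul_left c⁻¹).window hwA hside' hfar
  refine ⟨c⁻¹, hw, hside', ?_, ?_⟩
  · set K := c⁻¹ * S A * boost (P.len A / 2) with hK
    have hKI : K • I = I := by
      rw [hK, mul_assoc, mul_smul]
      change c⁻¹ • P.mid S A = I
      rw [← hca, inv_smul_smul]
    obtain ⟨h11, h10⟩ := entries_of_fix_I hKI
    have h00 : 0 < K 0 0 := by
      rw [hK, mul_boost_00]
      exact mul_pos hwA.1 (Real.exp_pos _)
    refine ⟨K 0 0, K 0 1, h00, ?_, rfl, rfl, h10, h11⟩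
    -- The sign of `y` says that the far end of the chord is not to the right of edge `A`.
    have hf := hfar A le_rfl hAB.le
    rw [← far_mul_boost D _ (P.len A / 2), ← hK] at hf
    unfold far at hf
    rw [h11, h10] at hf
    rw [Real.sinh_eq] at hsD
    by_contra hn
    push Not at hn
    have := mul_pos (mul_pos h00 hn) hsD
    linarith
  · set K := boost (-D) * (c⁻¹ * S B * boost (P.len B / 2)) with hK
    have hN : c⁻¹ * S B * boost (P.len B / 2) = boost D * K := by
      rw [hK, ← mul_assoc, boost_mul_boost, add_neg_cancel, boost_zero, one_mul]
    have hKI : K • I = I := by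
      rw [hK, mul_assoc, mul_smul, mul_smul]
      change boost (-D) • c⁻¹ • P.mid S B = I
      rw [← hcb, mul_smul, inv_smul_smul, ← mul_smul, boost_mul_boost, neg_add_cancel, boost_zero,
        one_smul]
    obtain ⟨h11, h10⟩ := entries_of_fix_I hKI
    have b00 : (boost D * K) 0 0 = Real.exp (D / 2) * K 0 0 := by
      rw [Matrix.SpecialLinearGroup.coe_mul, Matrix.mul_apply, Fin.sum_univ_two]; simp [boost]
    have b01 : (boost D * K) 0 1 = Real.exp (D / 2) * K 0 1 := by
      rw [Matrix.SpecialLinearGroup.coe_mul, Matrix.mul_apply, Fin.sum_univ_two]; simp [boost]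
    have b10 : (boost D * K) 1 0 = -(Real.exp (-(D / 2)) * K 0 1) := by
      rw [Matrix.SpecialLinearGroup.coe_mul, Matrix.mul_apply, Fin.sum_univ_two]; simp [boost, h10]
    have b11 : (boost D * K) 1 1 = Real.exp (-(D / 2)) * K 0 0 := by
      rw [Matrix.SpecialLinearGroup.coe_mul, Matrix.mul_apply, Fin.sum_univ_two]; simp [boost, h11]
    have h00 : 0 < K 0 0 := by
      have h := mul_boost_00 (c⁻¹ * S B) (P.len B / 2)
      rw [hN, b00] at h
      have h1 : 0 < Real.exp (D / 2) * K 0 0 := by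
        rw [h]
        exact mul_pos (hw B hAB.le le_rfl).1 (Real.exp_pos _)
      exact pos_of_mul_pos_right h1 (Real.exp_pos _).le
    refine ⟨K 0 0, K 0 1, h00, ?_, by rw [hN, b00], by rw [hN, b01], by rw [hN, b10], by rw [hN, b11]⟩
    rw [← far_mul_boost 0 _ (P.len B / 2), hN] at hfar0
    unfold far at hfar0
    rw [b00, b01, b10, b11, neg_zero, Real.exp_zero] at hfar0
    have hf : 0 ≤ K 0 0 * K 0 1 * (Real.exp D - Real.exp (-D)) := by
      rw [← exp_half_sq D, ← exp_neg_half_sq D]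
      linarith
    rw [Real.sinh_eq] at hsD
    by_contra hn
    push Not at hn
    have := mul_pos (mul_pos h00 (neg_pos.2 hn)) hsD
    linarith

end GreenBlackPolygon

/-! ### The arm lemma for polygons, and the closed loop. -/

namespace GreenBlackPolygon

open HypPlane

variable {n : ℕ} [NeZero n] {P P' : GreenBlackPolygon n}

/-- The angles at the green vertices and the lengths of the green edges between the black edges
`A` and `B` are at least as large in the first polygon as in the second. -/
structure Dominates (P P' : GreenBlackPolygon n) (A B : ℕ) : Prop where
  angle : ∀ j, A ≤ j → j < B → ¬P.IsGreen j → ¬P.IsGreen (j + 1) → P'.ang (j + 1) ≤ P.ang (j + 1)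
  length : ∀ j, A ≤ j → j + 1 < B → P.IsGreen (j + 1) → P'.len (j + 1) ≤ P.len (j + 1)

/-- The angle at a green vertex or the length of a green edge between the black edges `A` and `B`
is larger in the first polygon than in the second. -/
def Exceeds (P P' : GreenBlackPolygon n) (A B : ℕ) : Prop :=
  (∃ j, A ≤ j ∧ j < B ∧ ¬P.IsGreen j ∧ ¬P.IsGreen (j + 1) ∧ P'.ang (j + 1) < P.ang (j + 1)) ∨
    ∃ j, A ≤ j ∧ j + 2 ≤ B ∧ P.IsGreen (j + 1) ∧ P'.len (j + 1) < P.len (j + 1)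

/-- The arm lemma for green-black polygons. -/
theorem dist_mid_lt {S S' : ℕ → SL(2, ℝ)} (hS : P.IsFrames S) (hS' : P'.IsFrames S')
    (hcol : P'.IsGreen = P.IsGreen) (hlen : ∀ j, ¬P.IsGreen j → P.len j = P'.len j) {A B : ℕ}
    (hAB : A < B) (hn : B < A + n) (hA : ¬P.IsGreen A) (hB : ¬P.IsGreen B)
    (hd : P.Dominates P' A B) (he : P.Exceeds P' A B) :
    dist (P'.mid S' A) (P'.mid S' B) < dist (P.mid S A) (P.mid S B) := by
  obtain ⟨c, hw, hs, ⟨x, y, hx, hy, a00, a01, a10, a11⟩, ⟨u, v, hu, hv, b00, b01, b10, b11⟩⟩ :=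
    hS.exists_chord hAB hn
  obtain ⟨c', hw', hs', ⟨x', y', hx', hy', a00', a01', a10', a11'⟩,
    ⟨u', v', hu', hv', b00', b01', b10', b11'⟩⟩ := hS'.exists_chord hAB hn
  rw [← hlen A hA] at a00' a01' a10' a11'
  rw [← hlen B hB] at b00' b01' b10' b11'
  -- Moved to the midpoint, both frames at `A` are rotations, so the two determinants coincide. At
  -- `B` they are rotations followed by boosts of `D` and `D'`, which turns the ratio into `exp (D -
  -- D')`.
  have hcA : cross (c * S A) (c' * S' A) = x * x' + y * y' := by
    rw [← cross_mul_boost _ _ (P.len A / 2)]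
    unfold cross
    rw [a00, a01, a10', a11']; ring
  have hcA' : cross (c' * S' A) (c * S A) = x * x' + y * y' := by
    rw [← cross_mul_boost _ _ (P.len A / 2)]
    unfold cross
    rw [a00', a01', a10, a11]; ring
  set D := dist (P.mid S A) (P.mid S B) with hD
  set D' := dist (P'.mid S' A) (P'.mid S' B) with hD'
  have hcB : cross (c * S B) (c' * S' B) = Real.exp ((D - D') / 2) * (u * u' + v * v') := by
    rw [← cross_mul_boost _ _ (P.len B / 2)]
    unfold cross
    rw [b00, b01, b10', b11', show (D - D') / 2 = D / 2 + -(D' / 2) by ring, Real.exp_add]; ring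
  have hcB' : cross (c' * S' B) (c * S B) = Real.exp ((D' - D) / 2) * (u * u' + v * v') := by
    rw [← cross_mul_boost _ _ (P.len B / 2)]
    unfold cross
    rw [b00', b01', b10, b11, show (D' - D) / 2 = D' / 2 + -(D / 2) by ring, Real.exp_add]; ring
  have hposA : 0 < x * x' + y * y' :=
    add_pos_of_pos_of_nonneg (mul_pos hx hx') (mul_nonneg_of_nonpos_of_nonpos hy hy')
  have hposB : 0 < u * u' + v * v' :=
    add_pos_of_pos_of_nonneg (mul_pos hu hu') (mul_nonneg hv hv')
  have arc : IsRightArc P.IsGreen A B fun j => c * S j :=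
    { window := fun j h1 h2 => hw j h1.le h2.le
      window_left := ⟨(hw A le_rfl hAB.le).1.le, (hw A le_rfl hAB.le).2.le⟩
      window_right := ⟨(hw B hAB.le le_rfl).1.le, (hw B hAB.le le_rfl).2.le⟩
      side := fun j h1 h2 => (hs j h1 h2).le }
  have arc' : IsRightArc P.IsGreen A B fun j => c' * S' j :=
    { window := fun j h1 h2 => hw' j h1.le h2.le
      window_left := ⟨(hw' A le_rfl hAB.le).1.le, (hw' A le_rfl hAB.le).2.le⟩
      window_right := ⟨(hw' B hAB.le le_rfl).1.le, (hw' B hAB.le le_rfl).2.le⟩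
      side := fun j h1 h2 => (hs' j h1 h2).le }
  have pair : IsArmPair P.IsGreen A B P.len P'.len P.ang P'.ang (fun j => c * S j)
      (fun j => c' * S' j) :=
    { chain := hS.chain.mul_left c
      chain' := hcol ▸ hS'.chain.mul_left c'
      arc := arc
      arc' := arc'
      length_eq := hlen
      angle_le := hd.angle
      length_le := hd.length
      black_left := hA
      black_right := hB
      cross_left := by rw [hcA']; exact hposA
      cross_right := by rw [hcB']; positivity }
  have key : cross (c * S A) (c' * S' A) / cross (c' * S' A) (c * S A)
      < cross (c * S B) (c' * S' B) / cross (c' * S' B) (c * S B) := by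
    rcases he with ⟨j, h1, h2, h3, h4, h5⟩ | ⟨j, h1, h2, h3, h4⟩
    · exact pair.ratio_lt_of_angle h1 h2 h3 h4 h5 (hs (j + 1) (by omega) (by omega))
    · exact pair.ratio_lt_of_length h1 h2 h3 h4 (hw j h1 (by omega)) (hw (j + 2) (by omega) h2)
  rw [hcA, hcA', hcB, hcB', div_self hposA.ne', mul_div_mul_right _ _ hposB.ne',
    one_lt_div (Real.exp_pos _), Real.exp_lt_exp] at key
  linarith

/-- The frames of a polygon, seen from the line of an edge. -/
theorem IsFrames.exists_loop {S : ℕ → SL(2, ℝ)} (hS : P.IsFrames S) (A : ℕ) : ∃ c : SL(2, ℝ),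
      (∀ j, A < j → j < A + n → 0 < (c * S j) 0 0 ∧ 0 < (c * S j) 1 1) ∧
      (∀ j, A + 1 < j → j < A + n → 0 < side (c * S j)) ∧
      side (c * S (A + 1)) = 0 ∧
      ((c * S A) 0 0 = 0 ∧ (c * S A) 0 1 = -Real.exp (P.len A / 2) ∧
        (c * S A) 1 0 = Real.exp (-(P.len A / 2)) ∧ (c * S A) 1 1 = 0) ∧
      ((c * S (A + n)) 0 0 = 0 ∧ (c * S (A + n)) 0 1 = Real.exp (P.len A / 2) ∧
        (c * S (A + n)) 1 0 = -Real.exp (-(P.len A / 2)) ∧ (c * S (A + n)) 1 1 = 0) := by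
  have h3 := P.three_le
  set l := P.len A with hl
  have hlpos : 0 < l := P.len_pos A
  -- `turn 0` reverses direction: this frame sits at vertex `A + 1` and looks back to vertex `A`,
  -- with the rest of the polygon on its right.
  set g := S A * boost l * turn 0 with hg
  have t00 : turn 0 0 0 = 0 := by simp [turn]
  have t01 : turn 0 0 1 = 1 := by simp [turn]
  have t10 : turn 0 1 0 = -1 := by simp [turn]
  have t11 : turn 0 1 1 = 0 := by simp [turn]
  obtain ⟨w00, w01, w10, w11⟩ := inv_entries (turn 0)
  rw [t11] at w00
  rw [t01] at w01
  rw [t10, neg_neg] at w10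
  rw [t00] at w11
  have hga : g • I = P.vtx (A + 1) := by
    rw [hg, mul_smul, turn_smul_I, hS.finish]
  have hgb : (g * boost l) • I = P.vtx A := by
    have : turn 0 * boost l = boost (-l) * turn 0 := by
      apply sl_ext
      · rw [mul_boost_00, mul_turn_00, boost_00, boost_01, t00]; simp
      · rw [mul_boost_01, mul_turn_01, boost_00, boost_01, t01]; simp [neg_div]
      · rw [mul_boost_10, mul_turn_10, boost_10, boost_11, t10]; simp [neg_div]
      · rw [mul_boost_11, mul_turn_11, boost_10, boost_11, t11]; simp
    rw [hg, mul_assoc, this, mul_assoc, ← mul_assoc (boost l), boost_mul_boost, add_neg_cancel,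
      boost_zero, one_mul, mul_smul, turn_smul_I, hS.start]
  have hsl : ∀ j, 0 < 2 * Real.sinh (P.len j) := fun j =>
    mul_pos (by norm_num) (Real.sinh_pos_iff.2 (P.len_pos j))
  have hside : ∀ j, A + 1 < j → j < A + n → 0 < side (g⁻¹ * S j) := by
    intro j h1 h2
    have e := orient_frame g (S j) l
    rw [hga, hgb, hS.start, orient_swap] at e
    have := P.orient_pos (i := A + 1) (j := j) (k := A + n) h1 h2 (by omega)
    rw [vtx_period] at this
    exact pos_of_mul_pos_left (show 0 < side (g⁻¹ * S j) * (2 * Real.sinh l) by linarith) (hsl A).le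
  have hfar : ∀ j, A + 1 ≤ j → j ≤ A + n - 1 → 0 ≤ far l (g⁻¹ * S j) := by
    intro j h1 h2
    have e := orient_far (S j) g (P.len j) l
    rw [hgb, hS.start, hS.finish] at e
    have := P.orient_nonneg (i := j) (j := j + 1) (k := A + n) (by omega) (by omega) (by omega)
    rw [vtx_period, e] at this
    exact nonneg_of_mul_nonneg_left this (hsl j)
  have hend : g⁻¹ * S A * boost l = (turn 0)⁻¹ := by rw [hg]; group
  have hA1 : g⁻¹ * S (A + 1) = (turn 0)⁻¹ * turn (P.ang (A + 1)) := by
    rw [hS.chain.step, ← hend, ← hl]; group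
  have ha := half_angle_pos (hS.chain.angle_pos (A + 1)) (hS.chain.angle_lt (A + 1))
  have hw1 : 0 < (g⁻¹ * S (A + 1)) 0 0 ∧ 0 < (g⁻¹ * S (A + 1)) 1 1 := by
    rw [hA1, mul_turn_00, mul_turn_11, w00, w01, w10, w11]
    simp [ha.2]
  have hw := (hS.chain.mul_left g⁻¹).window (B := A + n - 1) hw1
    (fun j h1 h2 => hside j h1 (by omega)) hfar
  have hMA : g⁻¹ * S A = (turn 0)⁻¹ * boost (-l) := by
    rw [← hend, mul_assoc _ (boost l), boost_mul_boost, add_neg_cancel, boost_zero, mul_one]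
  have hm00 : (g⁻¹ * S A) 0 0 = 0 := by rw [hMA, mul_boost_00, w00]; simp
  have hm01 : (g⁻¹ * S A) 0 1 = -Real.exp (l / 2) := by
    rw [hMA, mul_boost_01, w01]; simp [neg_div]
  have hm10 : (g⁻¹ * S A) 1 0 = Real.exp (-(l / 2)) := by
    rw [hMA, mul_boost_10, w10]; simp [neg_div]
  have hm11 : (g⁻¹ * S A) 1 1 = 0 := by rw [hMA, mul_boost_11, w11]; simp
  -- the frame after one round
  set K := (S A)⁻¹ * S (A + n) with hK
  have hSK : g⁻¹ * S (A + n) = g⁻¹ * S A * K := by rw [hK]; group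
  have hKI : K • I = I := by
    rw [hK, mul_smul, hS.start, vtx_period, ← hS.start, inv_smul_smul]
  have hKb : (K * boost l) • I = boost l • I := by
    have h1 := hS.finish (A + n)
    rw [len_period, show A + n + 1 = A + 1 + n by omega, vtx_period] at h1
    rw [hK, mul_assoc, mul_smul, h1, ← hS.finish A, mul_smul, inv_smul_smul]
  obtain ⟨k11, k10⟩ := entries_of_fix_I hKI
  have k01 : K 0 1 = 0 := by
    have e := coordA_smul_I (K * boost l)
    rw [hKb, (coord_boost l).1, mul_boost_10, mul_boost_11, k10, k11, mul_pow, mul_pow, exp_half_sq,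
      exp_neg_half_sq] at e
    have d := sl_det K
    rw [k10, k11] at d
    have hs := hsl A
    rw [← hl, Real.sinh_eq] at hs
    have : K 0 1 ^ 2 * (2 * ((Real.exp l - Real.exp (-l)) / 2)) = 0 := by
      linear_combination -e + (-Real.exp (-l)) * d
    rcases mul_eq_zero.1 this with h | h
    · exact pow_eq_zero_iff (two_ne_zero) |>.1 h
    · exact absurd h hs.ne'
  rw [k01, neg_zero] at k10
  have hsq : K 0 0 * K 0 0 = 1 := by
    have d := sl_det K
    rw [k10, k11] at d
    linarith
  have hMK : ∀ (M : SL(2, ℝ)), (M * K) 0 0 = M 0 0 * K 0 0 ∧ (M * K) 0 1 = M 0 1 * K 0 0 ∧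
      (M * K) 1 0 = M 1 0 * K 0 0 ∧ (M * K) 1 1 = M 1 1 * K 0 0 := by
    intro M
    refine ⟨?_, ?_, ?_, ?_⟩ <;>
      rw [Matrix.SpecialLinearGroup.coe_mul, Matrix.mul_apply, Fin.sum_univ_two] <;>
      simp [k01, k10, k11]
  obtain ⟨e00, e01, e10, e11⟩ := hMK (g⁻¹ * S A)
  rw [← hSK, hm00, zero_mul] at e00
  rw [← hSK, hm01] at e01
  rw [← hSK, hm10] at e10
  rw [← hSK, hm11, zero_mul] at e11
  -- `K` fixes both ends of the edge, hence is `1` or `-1`. A full circuit lifts to `-1`, as the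
  -- positive entry before the last corner shows.
  have k00 : K 0 0 = -1 := by
    have hb := half_angle_pos (hS.chain.angle_pos (A + n)) (hS.chain.angle_lt (A + n))
    have e := (hS.chain.mul_left g⁻¹).step (A + n - 1)
    rw [show A + n - 1 + 1 = A + n by omega] at e
    have p := mul_pos (hw (A + n - 1) (by omega) le_rfl).1 (Real.exp_pos (P.len (A + n - 1) / 2))
    rw [← mul_boost_00] at p
    set N := g⁻¹ * S (A + n - 1) * boost (P.len (A + n - 1))
    have q0 := mul_turn_00 N (P.ang (A + n))
    have q1 := mul_turn_01 N (P.ang (A + n))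
    rw [← e, e00] at q0
    rw [← e, e01] at q1
    have hneg : K 0 0 < 0 := by
      by_contra hn
      push Not at hn
      have r : N 0 0 = -Real.exp (l / 2) * K 0 0 * Real.cos (P.ang (A + n) / 2) := by
        have := Real.sin_sq_add_cos_sq (P.ang (A + n) / 2)
        rw [q1]
        linear_combination (-(N 0 0)) * this - Real.sin (P.ang (A + n) / 2) * q0
      have := mul_nonneg (mul_nonneg (Real.exp_pos (l / 2)).le hn) hb.2.le
      linarith
    nlinarith
  rw [k00] at e01 e10
  refine ⟨g⁻¹, fun j h1 h2 => hw j h1 (by omega), hside, ?_, ⟨hm00, hm01, hm10, hm11⟩, e00,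
    by rw [e01]; ring, by rw [e10]; ring, e11⟩
  rw [hA1, side_mul_turn]
  unfold side
  rw [w00, w11]
  ring

/-- If the first polygon dominates the second, they agree away from any given black edge. -/
theorem eq_of_dominates {S S' : ℕ → SL(2, ℝ)} (hS : P.IsFrames S) (hS' : P'.IsFrames S')
    (hcol : P'.IsGreen = P.IsGreen) (hlen : ∀ j, ¬P.IsGreen j → P.len j = P'.len j) {A : ℕ}
    (hA : ¬P.IsGreen A) (hd : P.Dominates P' A (A + n)) : ¬P.Exceeds P' (A + 1) (A + n - 1) := by
  intro he
  have h3 := P.three_le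
  obtain ⟨c, hw, hs, hs1, ⟨a00, a01, a10, a11⟩, ⟨b00, b01, b10, b11⟩⟩ := hS.exists_loop A
  obtain ⟨c', hw', hs', hs1', ⟨a00', a01', a10', a11'⟩, ⟨b00', b01', b10', b11'⟩⟩ :=
    hS'.exists_loop A
  rw [← hlen A hA] at a01' a10' b01' b10'
  have e := exp_half_mul (P.len A)
  have hcA : cross (c * S A) (c' * S' A) = 1 := by
    unfold cross; rw [a00, a01, a10', a11']; linarith
  have hcA' : cross (c' * S' A) (c * S A) = 1 := by
    unfold cross; rw [a00', a01', a10, a11]; linarith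
  have hcB : cross (c * S (A + n)) (c' * S' (A + n)) = 1 := by
    unfold cross; rw [b00, b01, b10', b11']; linarith
  have hcB' : cross (c' * S' (A + n)) (c * S (A + n)) = 1 := by
    unfold cross; rw [b00', b01', b10, b11]; linarith
  have arc : IsRightArc P.IsGreen A (A + n) fun j => c * S j :=
    { window := hw
      window_left := ⟨a00.ge, a11.ge⟩
      window_right := ⟨b00.ge, b11.ge⟩
      side := by
        intro j h1 h2
        rcases h2.eq_or_lt with rfl | h2
        · unfold side; rw [b00, b11]; simp
        rcases (Nat.succ_le_of_lt h1).eq_or_lt with rfl | h1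
        · exact hs1.ge
        · exact (hs j h1 h2).le }
  have arc' : IsRightArc P.IsGreen A (A + n) fun j => c' * S' j :=
    { window := hw'
      window_left := ⟨a00'.ge, a11'.ge⟩
      window_right := ⟨b00'.ge, b11'.ge⟩
      side := by
        intro j h1 h2
        rcases h2.eq_or_lt with rfl | h2
        · unfold side; rw [b00', b11']; simp
        rcases (Nat.succ_le_of_lt h1).eq_or_lt with rfl | h1
        · exact hs1'.ge
        · exact (hs' j h1 h2).le }
  have pair : IsArmPair P.IsGreen A (A + n) P.len P'.len P.ang P'.ang (fun j => c * S j)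
      (fun j => c' * S' j) :=
    { chain := hS.chain.mul_left c
      chain' := hcol ▸ hS'.chain.mul_left c'
      arc := arc
      arc' := arc'
      length_eq := hlen
      angle_le := hd.angle
      length_le := hd.length
      black_left := hA
      black_right := by rwa [isGreen_period]
      cross_left := by rw [hcA']; norm_num
      cross_right := by rw [hcB']; norm_num }
  -- Both ends of edge `A` lie on the axis, where `side` vanishes and the window degenerates; this
  -- is why the range of `Exceeds` is trimmed. Both ratios are `1`, so a strict increment is absurd.
  have key : cross (c * S A) (c' * S' A) / cross (c' * S' A) (c * S A)
      < cross (c * S (A + n)) (c' * S' (A + n)) / cross (c' * S' (A + n)) (c * S (A + n)) := by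
    rcases he with ⟨j, h1, h2, h3, h4, h5⟩ | ⟨j, h1, h2, h3, h4⟩
    · exact pair.ratio_lt_of_angle (by omega) (by omega) h3 h4 h5
        (hs (j + 1) (by omega) (by omega))
    · exact pair.ratio_lt_of_length (by omega) (by omega) h3 h4 (hw j (by omega) (by omega))
        (hw (j + 2) (by omega) (by omega))
  rw [hcA, hcA', hcB, hcB'] at key
  exact lt_irrefl _ key

/-- The loop with its first green edge evaluated explicitly; the vanishing diagonal after one
circuit then rules out polygons with too many right angles. -/
theorem IsFrames.exists_loop_green {S : ℕ → SL(2, ℝ)} (hS : P.IsFrames S) {A : ℕ}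
    (hg : P.IsGreen (A + 1)) : ∃ c : SL(2, ℝ),
      ((c * S (A + 2)) 0 0 = Real.cosh (P.len (A + 1) / 2) ∧
        (c * S (A + 2)) 0 1 = Real.sinh (P.len (A + 1) / 2) ∧
        (c * S (A + 2)) 1 0 = Real.sinh (P.len (A + 1) / 2) ∧
        (c * S (A + 2)) 1 1 = Real.cosh (P.len (A + 1) / 2)) ∧
      (c * S (A + n)) 0 0 = 0 ∧ (c * S (A + n)) 1 1 = 0 := by
  obtain ⟨c, -, -, -, ⟨a00, a01, a10, a11⟩, b00, -, -, b11⟩ := hS.exists_loop A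
  have e := exp_half_mul (P.len A)
  refine ⟨c, ⟨?_, ?_, ?_, ?_⟩, b00, b11⟩
  · rw [(hS.chain.mul_left c).two_step hg, mul_detour_00, mul_boost_00, mul_boost_01, a00, a01]
    linear_combination Real.cosh (P.len (A + 1) / 2) * e
  · rw [(hS.chain.mul_left c).two_step hg, mul_detour_01, mul_boost_00, mul_boost_01, a00, a01]
    linear_combination Real.sinh (P.len (A + 1) / 2) * e
  · rw [(hS.chain.mul_left c).two_step hg, mul_detour_10, mul_boost_10, mul_boost_11, a10, a11]
    linear_combination Real.sinh (P.len (A + 1) / 2) * e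
  · rw [(hS.chain.mul_left c).two_step hg, mul_detour_11, mul_boost_10, mul_boost_11, a10, a11]
    linear_combination Real.cosh (P.len (A + 1) / 2) * e

/-- There is no hyperbolic triangle with two right angles. -/
theorem not_green_of_three {S : ℕ → SL(2, ℝ)} (hS : P.IsFrames S) (hn : n = 3) (j : ℕ) :
    ¬P.IsGreen (j + 1) := by
  intro hg
  obtain ⟨c, ⟨-, -, m10, m11⟩, -, b11⟩ := hS.exists_loop_green hg
  rw [show j + n = j + 2 + 1 by omega, (hS.chain.mul_left c).step, mul_turn_11, mul_boost_10,
    mul_boost_11, m10, m11] at b11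
  have ha := half_angle_pos (hS.chain.angle_pos (j + 2 + 1)) (hS.chain.angle_lt (j + 2 + 1))
  have hs : 0 < Real.sinh (P.len (j + 1) / 2) := Real.sinh_pos_iff.2 (half_pos (P.len_pos _))
  have h1 := mul_pos (mul_pos hs (Real.exp_pos (P.len (j + 2) / 2))) ha.2
  have h2 := mul_pos (mul_pos (Real.cosh_pos (P.len (j + 1) / 2))
    (Real.exp_pos (-(P.len (j + 2) / 2)))) ha.1
  linarith

/-- There is no hyperbolic quadrilateral with four right angles. -/
theorem not_green_of_four {S : ℕ → SL(2, ℝ)} (hS : P.IsFrames S) (hn : n = 4) (j : ℕ)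
    (h1 : P.IsGreen (j + 1)) : ¬P.IsGreen (j + 3) := by
  intro hg
  obtain ⟨c, ⟨m00, m01, m10, m11⟩, b00, b11⟩ := hS.exists_loop_green h1
  rw [show j + n = j + 2 + 2 by omega, (hS.chain.mul_left c).two_step (j := j + 2) hg,
    mul_detour_00, mul_boost_00, mul_boost_01, m00, m01] at b00
  rw [show j + n = j + 2 + 2 by omega, (hS.chain.mul_left c).two_step (j := j + 2) hg,
    mul_detour_11, mul_boost_10, mul_boost_11, m10, m11] at b11
  have hX : 0 < Real.cosh (P.len (j + 1) / 2) * Real.sinh (P.len (j + 2 + 1) / 2) :=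
    mul_pos (Real.cosh_pos _) (Real.sinh_pos_iff.2 (half_pos (P.len_pos _)))
  have hY : 0 < Real.sinh (P.len (j + 1) / 2) * Real.cosh (P.len (j + 2 + 1) / 2) :=
    mul_pos (Real.sinh_pos_iff.2 (half_pos (P.len_pos _))) (Real.cosh_pos _)
  set X := Real.cosh (P.len (j + 1) / 2) * Real.sinh (P.len (j + 2 + 1) / 2)
  set Y := Real.sinh (P.len (j + 1) / 2) * Real.cosh (P.len (j + 2 + 1) / 2)
  have hlt : Real.exp (-(P.len (j + 2) / 2)) < Real.exp (P.len (j + 2) / 2) :=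
    Real.exp_lt_exp.2 (by linarith [P.len_pos (j + 2)])
  have e1 : X * Real.exp (P.len (j + 2) / 2) = Y * Real.exp (-(P.len (j + 2) / 2)) := by
    linear_combination b00
  have e2 : Y * Real.exp (P.len (j + 2) / 2) = X * Real.exp (-(P.len (j + 2) / 2)) := by
    linear_combination b11
  -- Adding `e1` and `e2` equates the two sides of this strict inequality.
  have h := mul_lt_mul_of_pos_left hlt (add_pos hX hY)
  linarith

end GreenBlackPolygon

/-! ### Counting sign changes in cyclic lists. -/

section changes

variable {α : Type*} [DecidableEq α]

/-- The number of changes met in passing from `x` through the list `m` to `y`. -/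
def listChanges (x : α) (m : List α) (y : α) : ℕ :=
  ((x :: m).zip (m ++ [y])).countP fun p => p.1 ≠ p.2

theorem listChanges_nil (x y : α) : listChanges x [] y = if x = y then 0 else 1 := by
  unfold listChanges
  by_cases h : x = y <;> simp [h]

theorem listChanges_cons (x z : α) (m : List α) (y : α) :
    listChanges x (z :: m) y = (if x = z then 0 else 1) + listChanges z m y := by
  unfold listChanges
  rw [List.cons_append, List.zip_cons_cons, List.countP_cons, add_comm]
  by_cases h : x = z <;> simp [h]

/-- The triangle inequality for the discrete metric: a stop at `z` cannot lose a change. -/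
theorem listChanges_le (x z : α) (m : List α) (y : α) :
    listChanges x m y ≤ (if x = z then 0 else 1) + listChanges z m y := by
  cases m with
  | nil =>
    rw [listChanges_nil, listChanges_nil]
    split_ifs <;> grind
  | cons w m =>
    rw [listChanges_cons, listChanges_cons]
    split_ifs <;> grind

theorem listChanges_mono {m' m : List α} (h : m'.Sublist m) (x y : α) :
    listChanges x m' y ≤ listChanges x m y := by
  induction h generalizing x with
  | slnil => exact le_rfl
  | cons a h ih =>
    rw [listChanges_cons]
    exact (listChanges_le x a _ y).trans (Nat.add_le_add_left (ih a) _)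
  | cons_cons a h ih =>
    rw [listChanges_cons, listChanges_cons]
    exact Nat.add_le_add_left (ih a) _

theorem four_le_cyclic_changes {m : List α} {a b c d : α} (h : [a, b, c, d].Sublist m) (hab : a ≠ b)
    (hbc : b ≠ c) (hcd : c ≠ d) (hda : d ≠ a) :
    4 ≤ (m.zip (m.rotate 1)).countP fun p => p.1 ≠ p.2 := by
  cases m with
  | nil => simp at h
  | cons x m =>
    have hr : (x :: m).rotate 1 = m ++ [x] := by simp
    rw [hr]
    change 4 ≤ listChanges x m x
    -- The cycle is opened at its head `x`. If `x` is not the chosen `a`, the passages from `x` to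
    -- `a` and from `d` to `x` still contribute a change, since `d ≠ a`.
    cases h with
    | cons _ h =>
      refine le_trans ?_ (listChanges_mono h x x)
      simp only [listChanges_cons, listChanges_nil, hab, hbc, hcd, if_false]
      split_ifs with h1 h2 <;> first | omega | exact absurd (h2.trans h1) hda
    | cons_cons _ h =>
      refine le_trans ?_ (listChanges_mono h a a)
      simp [listChanges_cons, listChanges_nil, hab, hbc, hcd, hda]

end changes

theorem four_le_cyclicSignChanges {f : ℕ → SignType} {N i j k l : ℕ} (hij : i < j) (hjk : j < k)
    (hkl : k < l) (hl : l < N) {σ : SignType} (hσ : σ ≠ 0) (hi : f i = σ) (hj : f j = -σ)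
    (hk : f k = σ) (hl' : f l = -σ) :
    4 ≤ GreenBlackPolygon.cyclicSignChanges ((List.range N).map f) := by
  have hsub : [i, j, k, l].Sublist (List.range N) := by
    apply List.sublist_of_subperm_of_pairwise (r := (· < ·))
    · apply List.subperm_of_subset
      · simp; omega
      · intro x hx
        simp at hx ⊢
        omega
    · simp; omega
    · exact List.pairwise_lt_range
  have h2 := (hsub.map f).filter (fun s => s ≠ 0)
  have hne : σ ≠ -σ := by
    revert hσ; cases σ <;> decide
  have hneg : -σ ≠ 0 := by
    revert hσ; cases σ <;> decide
  simp only [List.map_cons, List.map_nil, hi, hj, hk, hl'] at h2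
  rw [List.filter_cons_of_pos (by simpa using hσ), List.filter_cons_of_pos (by simpa using hneg),
    List.filter_cons_of_pos (by simpa using hσ), List.filter_cons_of_pos (by simpa using hneg),
    List.filter_nil] at h2
  exact four_le_cyclic_changes h2 hne hne.symm hne hne.symm

/-- A cyclic sequence of labels with fewer than four sign changes has none or splits into two
arcs of opposite sign. -/
theorem exists_split_of_cyclicSignChanges_lt {f : ℕ → SignType} {N : ℕ} (hper : ∀ k, f (k + N) = f k)
    (h : ¬4 ≤ GreenBlackPolygon.cyclicSignChanges ((List.range N).map f)) :
    (∀ k < N, f k = 0) ∨ (∃ σ : SignType, σ ≠ 0 ∧ (∀ k < N, f k ≠ -σ) ∧ ∃ k < N, f k = σ) ∨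
      ∃ σ : SignType, σ ≠ 0 ∧ ∃ s t, s < t ∧ t < s + N ∧ f s = σ ∧ f t = -σ ∧
        (∀ k, s ≤ k → k < t → f k ≠ -σ) ∧ ∀ k, t ≤ k → k < s + N → f k ≠ σ := by
  classical
  by_cases hz : ∀ k < N, f k = 0
  · exact Or.inl hz
  right
  push Not at hz
  set s := Nat.find hz with hs
  obtain ⟨hsN, hs0⟩ := Nat.find_spec hz
  have hsmin : ∀ k < s, f k = 0 := by
    intro k hk
    by_contra h0
    exact Nat.find_min hz hk ⟨by omega, h0⟩
  rw [← hs] at hsN hs0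
  generalize hσ : f s = σ at hs0
  by_cases ht : ∃ k, k < N ∧ f k = -σ
  swap
  · exact Or.inl ⟨σ, hs0, fun k hk he => ht ⟨k, hk, he⟩, s, hsN, hσ⟩
  right
  have hneg : -σ ≠ 0 := by
    revert hs0; cases σ <;> decide
  have hne : σ ≠ -σ := by
    revert hs0; cases σ <;> decide
  set t := Nat.find ht with ht'
  obtain ⟨htN, htσ⟩ := Nat.find_spec ht
  have htmin : ∀ k < t, f k ≠ -σ := fun k hk h0 => Nat.find_min ht hk ⟨by omega, h0⟩
  rw [← ht'] at htN htσ
  have hst : s < t := by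
    rcases lt_trichotomy s t with h | h | h
    · exact h
    · rw [← h, hσ] at htσ; exact absurd htσ hne
    · rw [hsmin t h] at htσ; exact absurd htσ.symm hneg
  -- If `σ` recurs after `t`, the arcs are cut at `t` and at the first recurrence `u`; a further
  -- `-σ` before `N` would complete four alternating labels.
  by_cases hu : ∃ k, t < k ∧ k < N ∧ f k = σ
  · set u := Nat.find hu with hu'
    obtain ⟨htu, huN, huσ⟩ := Nat.find_spec hu
    have humin : ∀ k < u, t < k → f k ≠ σ := fun k hk h1 h0 =>
      Nat.find_min hu hk ⟨h1, by omega, h0⟩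
    rw [← hu'] at htu huN huσ
    refine ⟨-σ, hneg, t, u, htu, by omega, htσ, by rw [neg_neg]; exact huσ, ?_, ?_⟩
    · intro k h1 h2
      rw [neg_neg]
      rcases h1.eq_or_lt with rfl | h1
      · rw [htσ]; exact hne.symm
      · exact humin k h2 h1
    · intro k h1 h2
      rcases lt_or_ge k N with hk | hk
      · intro h0
        rcases h1.eq_or_lt with rfl | h1
        · rw [huσ] at h0; exact hne h0
        · exact h (four_le_cyclicSignChanges hst htu h1 hk hs0 hσ htσ huσ h0)
      · obtain ⟨k', rfl⟩ := Nat.exists_eq_add_of_le' hk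
        rw [hper]
        exact htmin k' (by omega)
  · push Not at hu
    refine ⟨σ, hs0, s, t, hst, by omega, hσ, htσ, fun k _ h2 => htmin k h2, ?_⟩
    intro k h1 h2
    rcases lt_or_ge k N with hk | hk
    · rcases h1.eq_or_lt with rfl | h1
      · rw [htσ]; exact hne.symm
      · exact hu k h1 hk
    · obtain ⟨k', rfl⟩ := Nat.exists_eq_add_of_le' hk
      rw [hper, hsmin k' (by omega)]
      exact hs0.symm

/-! ### Labels, and the exclusion of few sign changes. -/

namespace GreenBlackPolygon

open HypPlane

variable {n : ℕ} [NeZero n] (P P' : GreenBlackPolygon n)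

/-- The labels, indexed periodically by the natural numbers. -/
noncomputable def lab (k : ℕ) : SignType :=
  if k % 2 = 0 then P.vertexLabel P' (Fin.ofNat n (k / 2)) else P.edgeLabel P' (Fin.ofNat n (k / 2))

theorem lab_even (j : ℕ) : P.lab P' (2 * j) = P.vertexLabel P' (Fin.ofNat n j) := by
  unfold lab
  rw [if_pos (by omega), show 2 * j / 2 = j by omega]

theorem lab_odd (j : ℕ) : P.lab P' (2 * j + 1) = P.edgeLabel P' (Fin.ofNat n j) := by
  unfold lab
  rw [if_neg (by omega), show (2 * j + 1) / 2 = j by omega]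

theorem lab_period (k : ℕ) : P.lab P' (k + 2 * n) = P.lab P' k := by
  unfold lab
  rw [show (k + 2 * n) % 2 = k % 2 by omega, show (k + 2 * n) / 2 = k / 2 + n by omega,
    ofNat_add_period]

theorem labels_eq : P.labels P' = (List.range (2 * n)).map (P.lab P') := by
  have h : ∀ m, (List.range m).flatMap (fun j => [P.lab P' (2 * j), P.lab P' (2 * j + 1)])
      = (List.range (2 * m)).map (P.lab P') := by
    intro m
    induction m with
    | zero => simp
    | succ m ih =>
      rw [List.range_succ, List.flatMap_append, ih, show 2 * (m + 1) = 2 * m + 1 + 1 by ring,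
        List.range_succ, List.range_succ]
      simp
  rw [← h, ← List.map_coe_finRange_eq_range, List.flatMap_map]
  unfold labels
  congr 1
  funext i
  rw [lab_even, lab_odd]
  simp

theorem vertexColor_succ_eq_green (j : ℕ) :
    P.vertexColor (Fin.ofNat n (j + 1)) = GBColor.green ↔ ¬P.IsGreen j ∧ ¬P.IsGreen (j + 1) := by
  have h := P.vertexColor_eq_black_iff (Fin.ofNat n (j + 1))
  rw [ofNat_succ_sub] at h
  unfold IsGreen
  rw [← not_or, ← h]
  cases P.vertexColor (Fin.ofNat n (j + 1)) <;> simp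

theorem lab_vertex (j : ℕ) (h : ¬P.IsGreen j) (h' : ¬P.IsGreen (j + 1)) :
    P.lab P' (2 * j + 2) = SignType.sign (P.ang (j + 1) - P'.ang (j + 1)) := by
  rw [show 2 * j + 2 = 2 * (j + 1) by ring, lab_even]
  unfold vertexLabel
  rw [if_pos ((P.vertexColor_succ_eq_green j).2 ⟨h, h'⟩)]
  rfl

theorem lab_edge (j : ℕ) (h : P.IsGreen j) :
    P.lab P' (2 * j + 1) = SignType.sign (P.len j - P'.len j) := by
  rw [lab_odd]
  unfold edgeLabel
  rw [if_pos (show P.edgeColor (Fin.ofNat n j) = GBColor.green from h)]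
  rfl

theorem not_green_of_lab_vertex {j : ℕ} (h : P.lab P' (2 * j + 2) ≠ 0) :
    ¬P.IsGreen j ∧ ¬P.IsGreen (j + 1) := by
  rw [show 2 * j + 2 = 2 * (j + 1) by ring, lab_even] at h
  unfold vertexLabel at h
  rw [← vertexColor_succ_eq_green]
  by_contra hc
  rw [if_neg hc] at h
  exact h rfl

theorem green_of_lab_edge {j : ℕ} (h : P.lab P' (2 * j + 1) ≠ 0) : P.IsGreen j := by
  rw [lab_odd] at h
  unfold edgeLabel at h
  by_contra hc
  unfold IsGreen at hc
  rw [if_neg hc] at h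
  exact h rfl

variable {P P'}

theorem isGreen_eq (h : P.Compatible P') : P'.IsGreen = P.IsGreen := by
  funext j
  unfold IsGreen
  rw [h]

theorem lab_swap (h : P.Compatible P') (k : ℕ) : P'.lab P k = -P.lab P' k := by
  have hv : ∀ i, P.vertexColor i = GBColor.green ↔ P'.vertexColor i = GBColor.green := by
    intro i
    have h1 := P.vertexColor_eq_black_iff i
    have h2 := P'.vertexColor_eq_black_iff i
    rw [← h, ← h, ← h1] at h2
    cases h3 : P.vertexColor i <;> cases h4 : P'.vertexColor i <;> simp_all
  unfold lab vertexLabel edgeLabel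
  have he := h (Fin.ofNat n (k / 2))
  simp only [hv, he]
  split_ifs
  · rw [← Left.sign_neg, neg_sub]
  · simp
  · rw [← Left.sign_neg, neg_sub]
  · simp

theorem sign_ne_neg_one {x y : ℝ} (h : SignType.sign (x - y) ≠ -1) : y ≤ x := by
  by_contra hc
  push Not at hc
  exact h (sign_neg (by linarith))

theorem sign_eq_one {x y : ℝ} (h : SignType.sign (x - y) = 1) : y < x := by
  have := sign_eq_one_iff.1 h
  linarith

theorem dominates_of_lab {A B : ℕ} (h : ∀ k, 2 * A + 2 ≤ k → k < 2 * B + 2 → P.lab P' k ≠ -1) :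
    P.Dominates P' A B where
  angle j h1 h2 h3 h4 := by
    have := h (2 * j + 2) (by omega) (by omega)
    rw [lab_vertex _ _ j h3 h4] at this
    exact sign_ne_neg_one this
  length j h1 h2 h3 := by
    have := h (2 * (j + 1) + 1) (by omega) (by omega)
    rw [lab_edge _ _ (j + 1) h3] at this
    exact sign_ne_neg_one this

/-- A label is cut off by the black edge just before it: edge `A` precedes both vertex `A + 1`, at
position `2 * A + 2`, and a green edge `A + 1`, at position `2 * A + 3`. The bound `2 ≤ s` makes the
truncated subtraction exact. -/
theorem arc_of_labels {s t : ℕ} (h2 : 2 ≤ s) (hst : s < t) (hs : P.lab P' s = 1)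
    (ht : P.lab P' t ≠ 0) (h : ∀ k, s ≤ k → k < t → P.lab P' k ≠ -1) :
    ¬P.IsGreen (s / 2 - 1) ∧ ¬P.IsGreen (t / 2 - 1) ∧ s / 2 - 1 < t / 2 - 1 ∧
      P.Dominates P' (s / 2 - 1) (t / 2 - 1) ∧ P.Exceeds P' (s / 2 - 1) (t / 2 - 1) := by
  have hcase : ∀ s, 2 ≤ s → P.lab P' s ≠ 0 → ∃ A, s / 2 - 1 = A ∧ ¬P.IsGreen A ∧
      ((s = 2 * A + 2 ∧ ¬P.IsGreen (A + 1)) ∨ (s = 2 * A + 3 ∧ P.IsGreen (A + 1))) := by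
    intro s h2 hs
    refine ⟨s / 2 - 1, rfl, ?_⟩
    obtain ⟨A, hA⟩ : ∃ A, s = 2 * A + 2 ∨ s = 2 * (A + 1) + 1 := ⟨s / 2 - 1, by omega⟩
    have hA' : s / 2 - 1 = A := by omega
    rw [hA']
    rcases hA with rfl | rfl
    · have := P.not_green_of_lab_vertex P' hs
      exact ⟨this.1, Or.inl ⟨rfl, this.2⟩⟩
    · have := P.green_of_lab_edge P' hs
      exact ⟨P.isolated' _ this, Or.inr ⟨by ring, this⟩⟩
  obtain ⟨A, hA, hgA, hsA⟩ := hcase s h2 (by rw [hs]; decide)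
  obtain ⟨B, hB, hgB, htB⟩ := hcase t (by omega) ht
  rw [hA, hB]
  have hAB : A < B := by
    rcases hsA with ⟨e1, g1⟩ | ⟨e1, g1⟩ <;> rcases htB with ⟨e2, g2⟩ | ⟨e2, g2⟩
    · omega
    · have : A ≠ B := by rintro rfl; exact g1 g2
      omega
    · omega
    · omega
  refine ⟨hgA, hgB, hAB, dominates_of_lab ?_, ?_⟩
  · intro k h1 h2
    rcases le_or_gt s k with hk | hk
    · exact h k hk (by omega)
    · obtain ⟨e1, g1⟩ : s = 2 * A + 3 ∧ P.IsGreen (A + 1) := by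
        rcases hsA with e | e
        · omega
        · exact e
      -- The only position of the range before `s` is the initial vertex of the green edge, which is
      -- black and unlabelled.
      have hk' : k = 2 * A + 2 := by omega
      intro hc
      refine (P.not_green_of_lab_vertex P' (j := A) ?_).2 g1
      rw [← hk', hc]
      decide
  · rcases hsA with ⟨e1, g1⟩ | ⟨e1, g1⟩
    · left
      refine ⟨A, le_rfl, hAB, hgA, g1, ?_⟩
      rw [e1, lab_vertex _ _ A hgA g1] at hs
      exact sign_eq_one hs
    · right
      have : B ≠ A + 1 := by rintro rfl; exact hgB g1
      refine ⟨A, le_rfl, by omega, g1, ?_⟩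
      rw [e1, show 2 * A + 3 = 2 * (A + 1) + 1 by ring, lab_edge _ _ (A + 1) g1] at hs
      exact sign_eq_one hs

/-- Two arcs of opposite sign are impossible. -/
theorem no_split {S S' : ℕ → SL(2, ℝ)} (hS : P.IsFrames S) (hS' : P'.IsFrames S')
    (h : P.BlackEdgeCongruent P') {s t : ℕ} (hst : s < t) (htn : t < s + 2 * n)
    (hs : P.lab P' s = 1) (ht : P.lab P' t = -1)
    (h1 : ∀ k, s ≤ k → k < t → P.lab P' k ≠ -1)
    (h2 : ∀ k, t ≤ k → k < s + 2 * n → P.lab P' k ≠ 1) : False := by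
  wlog hs2 : 2 ≤ s generalizing s t
  · have h3 := P.three_le
    refine this (s := s + 2 * n) (t := t + 2 * n) (by omega) (by omega) (by rwa [lab_period])
      (by rwa [lab_period]) ?_ ?_ (by omega)
    · intro k a b
      obtain ⟨k, rfl⟩ := Nat.exists_eq_add_of_le' (show 2 * n ≤ k by omega)
      rw [lab_period]
      exact h1 k (by omega) (by omega)
    · intro k a b
      obtain ⟨k, rfl⟩ := Nat.exists_eq_add_of_le' (show 2 * n ≤ k by omega)
      rw [lab_period]
      exact h2 k (by omega) (by omega)
  have hcol := isGreen_eq h.1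
  have hlen : ∀ j, ¬P.IsGreen j → P.len j = P'.len j :=
    fun j hj => h.2 _ (gbColor_ne_green_iff.1 hj)
  obtain ⟨gA, gB, hAB, d1, e1⟩ := arc_of_labels hs2 hst hs (by rw [ht]; decide) h1
  have hneg : ∀ k, P'.lab P k = -P.lab P' k := lab_swap h.1
  obtain ⟨-, -, hBA, d2, e2⟩ := arc_of_labels (P := P') (P' := P) (s := t) (t := s + 2 * n) (by omega)
    htn (by rw [hneg, ht]; rfl) (by rw [hneg, lab_period, hs]; decide)
    (fun k a b hc => h2 k a b (by rw [hneg, neg_eq_iff_eq_neg, neg_neg] at hc; exact hc))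
  rw [show (s + 2 * n) / 2 - 1 = s / 2 - 1 + n by omega] at hBA d2 e2
  -- The complementary arcs span the same chord, with the roles of the polygons exchanged.
  have r1 := dist_mid_lt hS hS' hcol hlen hAB hBA gA gB d1 e1
  have r2 := dist_mid_lt hS' hS hcol.symm (fun j hj => (hlen j (hcol ▸ hj)).symm) hBA
    (by omega) (hcol ▸ gB) (by rw [isGreen_period]; exact hcol ▸ gA) d2 e2
  rw [hS.mid_period, hS'.mid_period, dist_comm, dist_comm (P'.mid S' _)] at r2
  exact lt_asymm r1 r2

/-- Labels of one sign only are impossible. -/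
theorem no_single_sign {S S' : ℕ → SL(2, ℝ)} (hS : P.IsFrames S) (hS' : P'.IsFrames S')
    (h : P.BlackEdgeCongruent P') (hall : ∀ k, P.lab P' k ≠ -1) {s : ℕ} (hs2 : 2 ≤ s)
    (hs : P.lab P' s = 1) : False := by
  have h3 := P.three_le
  have hcol := isGreen_eq h.1
  have hlen : ∀ j, ¬P.IsGreen j → P.len j = P'.len j :=
    fun j hj => h.2 _ (gbColor_ne_green_iff.1 hj)
  have key : ∀ A, ¬P.IsGreen A → ¬P.Exceeds P' (A + 1) (A + n - 1) := fun A hA =>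
    eq_of_dominates hS hS' hcol hlen hA (dominates_of_lab fun k _ _ => hall k)
  have hs0 : P.lab P' s ≠ 0 := by rw [hs]; decide
  obtain ⟨v, hv⟩ : ∃ v, s = 2 * v + 2 ∨ s = 2 * (v + 1) + 1 := ⟨s / 2 - 1, by omega⟩
  rcases hv with rfl | rfl
  · obtain ⟨g0, g1⟩ := P.not_green_of_lab_vertex P' hs0
    rw [lab_vertex _ _ v g0 g1] at hs
    have hlt := sign_eq_one hs
    -- A black edge not incident to vertex `v + 1`. The next candidate `v + 3` is available unless
    -- `n = 3`, when `v + 2` cannot be green.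
    obtain ⟨A, hA1, hA2, hA⟩ : ∃ A, v + 1 < A ∧ A + 1 ≤ v + n ∧ ¬P.IsGreen A := by
      by_cases hg : P.IsGreen (v + 2)
      · have : n ≠ 3 := fun hn => not_green_of_three hS hn (v + 1) hg
        exact ⟨v + 3, by omega, by omega, P.isolated _ hg⟩
      · exact ⟨v + 2, by omega, by omega, hg⟩
    refine key A hA (Or.inl ⟨v + n, by omega, by omega, ?_, ?_, ?_⟩)
    · rwa [isGreen_period]
    · rwa [show v + n + 1 = v + 1 + n by omega, isGreen_period]
    · rwa [show v + n + 1 = v + 1 + n by omega, ang_period, ang_period]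
  · have g := P.green_of_lab_edge P' hs0
    rw [lab_edge _ _ (v + 1) g] at hs
    have hlt := sign_eq_one hs
    have hn3 : n ≠ 3 := fun hn => not_green_of_three hS hn v g
    -- A black edge not adjacent to the green edge `v + 1`; for `n = 4` the only candidate is the
    -- opposite edge.
    obtain ⟨A, hA1, hA2, hA⟩ : ∃ A, v + 3 ≤ A ∧ A + 1 ≤ v + n ∧ ¬P.IsGreen A := by
      by_cases hg : P.IsGreen (v + 3)
      · have : n ≠ 4 := fun hn => not_green_of_four hS hn v g hg
        exact ⟨v + 4, by omega, by omega, P.isolated _ hg⟩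
      · exact ⟨v + 3, by omega, by omega, hg⟩
    refine key A hA (Or.inr ⟨v + n, by omega, by omega, ?_, ?_⟩)
    · rwa [show v + n + 1 = v + 1 + n by omega, isGreen_period]
    · rwa [show v + n + 1 = v + 1 + n by omega, len_period, len_period]

theorem congruent_of_lab_eq_zero {S S' : ℕ → SL(2, ℝ)} (hS : P.IsFrames S) (hS' : P'.IsFrames S')
    (h : P.BlackEdgeCongruent P') (hz : ∀ k, P.lab P' k = 0) : P.Congruent P' := by
  have hcol := isGreen_eq h.1
  have hang : ∀ j, ¬P.IsGreen j → ¬P.IsGreen (j + 1) → P.ang (j + 1) = P'.ang (j + 1) := by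
    intro j h0 h1
    have e := hz (2 * j + 2)
    rw [lab_vertex _ _ j h0 h1, sign_eq_zero_iff] at e
    linarith
  have hlen : ∀ j, P.len j = P'.len j := by
    intro j
    by_cases hj : P.IsGreen j
    · have e := hz (2 * j + 1)
      rw [lab_edge _ _ j hj, sign_eq_zero_iff] at e
      linarith
    · exact h.2 _ (gbColor_ne_green_iff.1 hj)
  have hang' : ∀ j, P.ang (j + 1) = P'.ang (j + 1) := by
    intro j
    by_cases h0 : P.IsGreen j
    · rw [(hS.chain.right j h0).2, (hS'.chain.right j (hcol ▸ h0)).2]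
    by_cases h1 : P.IsGreen (j + 1)
    · rw [(hS.chain.right (j + 1) h1).1, (hS'.chain.right (j + 1) (hcol ▸ h1)).1]
    exact hang j h0 h1
  have hof : ∀ i : Fin n, Fin.ofNat n i.val = i := fun i => by simp
  -- Both chains obey the same recursion by right multiplication, so they differ by a constant left
  -- factor, the isometry.
  have hframe : ∀ j, S' j = S' 0 * (S 0)⁻¹ * S j := by
    intro j
    induction j with
    | zero => group
    | succ j ih => rw [hS.chain.step, hS'.chain.step, ih, hlen, hang']; group
  refine ⟨h, ?_, ?_, IsometryEquiv.constSMul (S' 0 * (S 0)⁻¹), ?_⟩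
  · intro i _
    have e := hang' (i.val + n - 1)
    rw [show i.val + n - 1 + 1 = i.val + n by have := P.three_le; omega, ang_period, ang_period] at e
    unfold ang at e
    rwa [hof] at e
  · intro i _
    have e := hlen i.val
    unfold len at e
    rwa [hof] at e
  · intro i
    have e1 := hS.start i.val
    have e2 := hS'.start i.val
    unfold vtx at e1 e2
    rw [hof] at e1 e2
    rw [IsometryEquiv.constSMul_apply, ← e1, ← e2, ← mul_smul, ← hframe]

end GreenBlackPolygon

theorem mainTheorem5 {n : ℕ} [NeZero n] (P P' : GreenBlackPolygon n)
    (h : P.BlackEdgeCongruent P') :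
    P.Congruent P' ∨ 4 ≤ P.signChanges P' := by
  by_cases h4 : 4 ≤ P.signChanges P'
  · exact Or.inr h4
  left
  have h3 := P.three_le
  obtain ⟨S, hS, hS1, hS2⟩ := P.exists_frames
  obtain ⟨S', hS', hS1', hS2'⟩ := P'.exists_frames
  have F : P.IsFrames S := ⟨hS, hS1, hS2⟩
  have F' : P'.IsFrames S' := ⟨hS', hS1', hS2'⟩
  have hsymm : P'.BlackEdgeCongruent P :=
    ⟨fun i => (h.1 i).symm, fun i hi => (h.2 i ((h.1 i).trans hi)).symm⟩
  have hper := P.lab_period P'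
  have hmod : ∀ k, P.lab P' (k % (2 * n)) = P.lab P' k := by
    intro k
    induction k using Nat.strong_induction_on with
    | _ k ih =>
      rcases lt_or_ge k (2 * n) with hk | hk
      · rw [Nat.mod_eq_of_lt hk]
      · obtain ⟨k, rfl⟩ := Nat.exists_eq_add_of_le' hk
        rw [Nat.add_mod_right, hper]
        exact ih k (by omega)
  have hneg := GreenBlackPolygon.lab_swap h.1
  unfold GreenBlackPolygon.signChanges at h4
  rw [GreenBlackPolygon.labels_eq] at h4
  rcases exists_split_of_cyclicSignChanges_lt hper h4 with hz | ⟨σ, hσ, hall, s, hs, hsσ⟩ |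
    ⟨σ, hσ, s, t, hst, htn, hs, ht, h1, h2⟩
  · refine GreenBlackPolygon.congruent_of_lab_eq_zero F F' h fun k => ?_
    rw [← hmod]
    exact hz _ (Nat.mod_lt _ (by omega))
  · exfalso
    have hall' : ∀ k, P.lab P' k ≠ -σ := fun k => by
      rw [← hmod]
      exact hall _ (Nat.mod_lt _ (by omega))
    have hsσ' : P.lab P' (s + 2 * n) = σ := by rw [hper, hsσ]
    cases σ with
    | zero => exact hσ rfl
    | pos => exact GreenBlackPolygon.no_single_sign F F' h hall' (by omega) hsσ'
    | neg =>
      refine GreenBlackPolygon.no_single_sign F' F hsymm (fun k hk => hall' k ?_)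
        (s := s + 2 * n) (by omega) (by rw [hneg, hsσ']; rfl)
      rw [hneg, neg_eq_iff_eq_neg] at hk
      exact hk
  · exfalso
    cases σ with
    | zero => exact hσ rfl
    | pos => exact GreenBlackPolygon.no_split F F' h hst htn hs ht h1 h2
    | neg =>
      refine GreenBlackPolygon.no_split F' F hsymm hst htn (by rw [hneg, hs]; rfl)
        (by rw [hneg, ht]; rfl) ?_ ?_
      · intro k a b hk
        rw [hneg, neg_eq_iff_eq_neg] at hk
        exact h1 k a b hk
      · intro k a b hk
        rw [hneg, neg_eq_iff_eq_neg] at hk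
        exact h2 k a b hk
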